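/- Let $p\ge 3$. For $\beta\in\mathbb R$ and $n\ge 1$ let $\mathbb P_{\beta,p}$ be the $p$-tensor Curie-Weiss model on $\{-1,1\}^n$, $$\mathbb P_{\beta,p}(x)=\frac{\exp\{\beta n^{1-p}\sum_{1\le i_1,\dots,i_p\le n}x_{i_1}\cdots x_{i_p}\}}{2^nZ_n(\beta,p)},$$ where $Z_n(\beta,p)$ is the normalizing constant. Let $\hat\beta_{ML}$ be the maximizer over $b$ of the likelihood $\mathbb P_{b,p}(X)$, and let $\hat\beta_{MPL}$ be the maximizer over $b$ of the pseudolikelihood $\prod_{i=1}^n\mathbb P_{b,p}(X_i\mid (X_j)_{j\ne i})$ (both with values in $[-\infty,\infty]$). The usual closed form of the maximum pseudolikelihood estimator (exact up to a finite-sample correction) is $\eta_p(\overline X_n)$, where $\overline X_n=\frac1n\sum_i X_i$, $\eta_p(t)=p^{-1}t^{1-p}\tanh^{-1}(t)$ for $t\neq0$ (with limiting values $\pm\infty$ at $t=\pm1$) and $\eta_p(0)=0$; everything below is asserted both for the exact maximizer of the pseudolikelihood and for $\eta_p(\overline X_n)$, with one and the same slope $c_{MPL}$. For an estimator $\hat\beta$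 and a null parameter $\beta_0$ put $T_n=\sqrt n(\hat\beta-\beta_0)$ and let $L_n=1-F_{T_n,\beta_0}(T_n)$ be its $p$-value, where $F_{T_n,\beta_0}$ is the distribution function of $T_n$ under $\mathbb P_{\beta_0,p}$. The (weak) Bahadur slope of $\hat\beta$ at an alternative $\beta$ is the number $c_{\hat\beta}(\beta_0,\beta,p)$ such that $\frac1n\log L_n\to-\frac12c_{\hat\beta}(\beta_0,\beta,p)$ in $\mathbb P_{\beta,p}$-probability as $n\to\infty$. The asymptotic optimal sample size at level $\delta$ is $N^*_{\hat\beta}(\beta_0,\beta,\delta,p)=-2\log(\delta)/c_{\hat\beta}(\beta_0,\beta,p)$, and $\mathrm{eff}(\hat\beta_{ML},\hat\beta_{MPL};\beta_0,\beta)=c_{ML}(\beta_0,\beta,p)/c_{MPL}(\beta_0,\beta,p)$. Finally let $$\beta^*(p)=\sup\Big\{\beta\ge0:\sup_{x\in[-1,1]}H_{\beta,p}(x)=0\Big\},\qquad H_{\beta,p}(x)=\beta x^p-\tfrac12\{(1+x)\log(1+x)+(1-x)\log(1-x)\}.$$ 1. For every $\beta>\beta_0\ge\log2$ the slopes $c_{MPL}(\beta_0,\beta,p)$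 and $c_{ML}(\beta_0,\beta,p)$ exist, are positive and are equal; $N^*_{MPL}(\beta_0,\beta,\delta,p)=N^*_{ML}(\beta_0,\beta,\delta,p)$ for every $\delta\in(0,1)$; and $\mathrm{eff}(\hat\beta_{ML},\hat\beta_{MPL};\beta_0,\beta)=1$. 2. For every $\beta_0\in(\beta^*(p),\log2)$ there is $B$ such that for all $\beta>\beta_0$ with $\beta>B$ the slopes $c_{MPL}(\beta_0,\beta,p)$ and $c_{ML}(\beta_0,\beta,p)$ exist, are positive and are different; $N^*_{MPL}(\beta_0,\beta,\delta,p)\ne N^*_{ML}(\beta_0,\beta,\delta,p)$ for every $\delta\in(0,1)$; and $\mathrm{eff}(\hat\beta_{ML},\hat\beta_{MPL};\beta_0,\beta)>1$. -/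

import Mathlib

open Filter Topology

noncomputable section

namespace TensorCurieWeiss

/-! ### The `p`-tensor Curie-Weiss model on `{-1, 1}ⁿ` -/

/-- Spin configurations of length `n`; the units of `ℤ` are exactly `1` and `-1`. -/
abbrev Config (n : ℕ) : Type := Fin n → ℤˣ

/-- The numerical value (`1` or `-1`) of a spin. -/
def spin (s : ℤˣ) : ℝ := ((s : ℤ) : ℝ)

/-- The sufficient statistic `n^(1-p) ∑_{i₁, …, i_p} x_{i₁} ⋯ x_{i_p}`, the sum being over all
`p`-tuples of sites. -/
def hamiltonian (p : ℕ) {n : ℕ} (x : Config n) : ℝ :=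
  (n : ℝ) ^ (1 - (p : ℤ)) * ∑ i : Fin p → Fin n, ∏ j : Fin p, spin (x (i j))

/-- The normalizing constant `Z_n(β, p)`. -/
def partitionFn (p : ℕ) (β : ℝ) (n : ℕ) : ℝ :=
  (∑ x : Config n, Real.exp (β * hamiltonian p x)) / 2 ^ n

/-- The probability mass function of the model with parameter `β`. -/
def pmf (p : ℕ) (β : ℝ) {n : ℕ} (x : Config n) : ℝ :=
  Real.exp (β * hamiltonian p x) / (2 ^ n * partitionFn p β n)

open Classical in
/-- The probability of the event `A` in the model with parameter `β` and sample size `n`. -/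
def prob (p : ℕ) (β : ℝ) (n : ℕ) (A : Set (Config n)) : ℝ :=
  ∑ x : Config n, if x ∈ A then pmf p β x else 0

/-- The average magnetization (sample mean). -/
def magnetization {n : ℕ} (x : Config n) : ℝ := (∑ i, spin (x i)) / n

/-! ### Estimators -/

/-- `θ` maximizes `f : ℝ → ℝ` over the extended real line: either `θ` is a real number at which `f`
attains its maximum, or `θ = ±∞` and `f` tends to its supremum at `θ`. -/
def IsMaximizer (f : ℝ → ℝ) (θ : EReal) : Prop :=
  (∃ b : ℝ, θ = (b : EReal) ∧ ∀ y, f y ≤ f b) ∨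
  (θ = ⊤ ∧ Tendsto f atTop (𝓝 (⨆ y, f y))) ∨
  (θ = ⊥ ∧ Tendsto f atBot (𝓝 (⨆ y, f y)))

/-- The maximizer of `f` over the extended real line (the largest one, should there be several). -/
def argmax (f : ℝ → ℝ) : EReal := sSup {θ | IsMaximizer f θ}

/-- An estimator assigns an extended real number to each configuration of each length. -/
abbrev Estimator : Type := (n : ℕ) → Config n → EReal

/-- The maximum likelihood estimator. -/
def mle (p : ℕ) : Estimator := fun _ x => argmax fun b => pmf p b x

/-- The conditional probability of the observed spin `x i`, given all the other spins. -/
def condProb (p : ℕ) (β : ℝ) {n : ℕ} (x : Config n) (i : Fin n) : ℝ :=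
  pmf p β x / ∑ s : ℤˣ, pmf p β (Function.update x i s)

/-- The maximum pseudolikelihood estimator: the maximizer of the product of the conditional
probabilities of the individual spins. -/
def mple (p : ℕ) : Estimator := fun n x => argmax fun b => ∏ i : Fin n, condProb p b x i

/-- The function `η_p(t) = p⁻¹ t^(1-p) artanh t` on `[-1, 1]`, with `η_p(0) = 0` and the limiting
values `±∞` at `t = ±1` (where `artanh (±1) = ±∞`). -/
def eta (p : ℕ) (t : ℝ) : EReal :=
  if t = 0 then 0
  else if t = 1 then ⊤
  else if t = -1 then (if Even p then ⊤ else ⊥)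
  else (((p : ℝ)⁻¹ * t ^ (1 - (p : ℤ)) * Real.artanh t : ℝ) : EReal)

/-- The closed form `η_p` of the sample mean of the maximum pseudolikelihood estimator. It comes
from using the mean of all the spins in each local field, so that it differs from `mple` by a
finite-sample correction. -/
def mpleClosedForm (p : ℕ) : Estimator := fun _ x => eta p (magnetization x)

/-! ### Bahadur slopes -/

/-- The test statistic `T_n = √n (βhat - β₀)`; large values are significant. -/
def testStat (β₀ : ℝ) (est : Estimator) (n : ℕ) (x : Config n) : EReal :=
  ((Real.sqrt n : ℝ) : EReal) * (est n x - (β₀ : EReal))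

/-- The cumulative distribution function of `T_n` under the null parameter `β₀`. -/
def nullCdf (p : ℕ) (β₀ : ℝ) (est : Estimator) (n : ℕ) (t : EReal) : ℝ :=
  prob p β₀ n {x | testStat β₀ est n x ≤ t}

/-- The `p`-value `L_n = 1 - F(T_n)`. -/
def pValue (p : ℕ) (β₀ : ℝ) (est : Estimator) (n : ℕ) (x : Config n) : ℝ :=
  1 - nullCdf p β₀ est n (testStat β₀ est n x)

/-- `c` is the (weak) Bahadur slope at the alternative `β` of the test of `β₀` based on `est`:
`n⁻¹ log L_n → -c / 2` in probability under `β`. The configurations with `L_n = 0`, for which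
`log L_n = -∞`, are not counted as being close to the limit. -/
def IsBahadurSlope (p : ℕ) (β₀ β : ℝ) (est : Estimator) (c : ℝ) : Prop :=
  ∀ ε : ℝ, 0 < ε → Tendsto (fun n : ℕ => prob p β n {x | 0 < pValue p β₀ est n x ∧
    |(n : ℝ)⁻¹ * Real.log (pValue p β₀ est n x) - (-(1 / 2) * c)| ≤ ε}) atTop (𝓝 1)

/-- The asymptotic optimal sample size `N* = -2 log δ / c` at level `δ` of a test of slope `c`. -/
def optimalSampleSize (c δ : ℝ) : ℝ := -(2 * Real.log δ) / c

/-- The Bahadur asymptotic relative efficiency of a test of slope `c₁` with respect to a test of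
slope `c₂`. -/
def bahadurARE (c₁ c₂ : ℝ) : ℝ := c₁ / c₂

/-! ### The estimation threshold -/

/-- `H_{β,p}(x) = β x^p - ((1 + x) log (1 + x) + (1 - x) log (1 - x)) / 2`; the convention
`0 log 0 = 0` is in force at `x = ±1`. -/
def rateH (β : ℝ) (p : ℕ) (x : ℝ) : ℝ :=
  β * x ^ p - (1 / 2) * ((1 + x) * Real.log (1 + x) + (1 - x) * Real.log (1 - x))

/-- The threshold `β*(p) = sup {β ≥ 0 : sup_{x ∈ [-1, 1]} H_{β,p}(x) = 0}`. -/
def betaStar (p : ℕ) : ℝ :=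
  sSup {β : ℝ | 0 ≤ β ∧ sSup (rateH β p '' Set.Icc (-1) 1) = 0}

end TensorCurieWeiss

end

open Filter Topology

noncomputable section

namespace TensorCurieWeiss

/-! ### Counting configurations -/

/-! Write `H_β` for `rateH β p`. Under parameter `β` a magnetization `x` has mass `exp (n (H_β x -
max H_β))` up to factors polynomial in `n`. Hence the magnetization concentrates where `x ^ p = t ^
p`, with `t` the positive maximizer of `H_β`. The `p`-value is the null probability that the
estimator exceeds its observed value (`pValue_eq`), so the slope is twice the gap between `max H_β₀`
and the supremum of `H_β₀` over the magnetizations whose estimate is larger than at `t`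
(`isBahadurSlope_of_rate`).

On `(0, 1)` the derivative of `H_β` has the sign of `β - η_p`. As `η_p` is convex and blows up at
`0` and at `1`, the set where `η_p < β` is an interval `(s, t)` (`exists_isLevelPair`), and `H_β`
decreases from `0`, increases on `[s, t]`, then decreases. Let `t₀` be the maximizer for `β₀`; then
`t₀ < t`.

The likelihood estimator is strictly increasing in `x ^ p`, so its region is `x ^ p > t ^ p`, where
the supremum of `H_β₀` is `H_β₀ t` (`isBahadurSlope_mle`). The pseudolikelihood estimator follows
`η_p` (`tracksEta_mple`), which exceeds `β` on `(t, 1)` but also on `(0, s)`: small magnetizations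
imitate a large parameter. There `H_β₀` comes arbitrarily close to `0`, so the supremum becomes `max
0 (H_β₀ t)` (`isBahadurSlope_of_tracksEta`).

The slopes therefore differ exactly when `H_β₀ t < 0`. Since `H_β₀` decreases on `[t₀, 1]` to `β₀ -
log 2`, this never happens for `β₀ ≥ log 2`, and it happens for all large `β` otherwise, because `t`
then comes close enough to `1`. -/

/-- The number of spins equal to `1`. -/
def plusCount {n : ℕ} (x : Config n) : ℕ := (Finset.univ.filter fun i => x i = 1).card

/-- The value of the magnetization when `k` of the `n` spins are `1`. -/
def level (n k : ℕ) : ℝ := (2 * k - n) / n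

lemma plusCount_le {n : ℕ} (x : Config n) : plusCount x ≤ n := by
  simpa [plusCount] using Finset.card_le_univ (Finset.univ.filter fun i => x i = 1)

lemma spin_eq (s : ℤˣ) : spin s = 2 * (if s = 1 then (1 : ℝ) else 0) - 1 := by
  rcases Int.units_eq_one_or s with rfl | rfl
  · norm_num [spin]
  · have : (-1 : ℤˣ) ≠ 1 := by decide
    norm_num [spin, this]

lemma sum_spin {n : ℕ} (x : Config n) : ∑ i, spin (x i) = 2 * plusCount x - n := by
  simp only [spin_eq, Finset.sum_sub_distrib, ← Finset.mul_sum, plusCount]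
  simp

lemma magnetization_eq_level {n : ℕ} (x : Config n) :
    magnetization x = level n (plusCount x) := by
  rw [magnetization, level, sum_spin]

lemma hamiltonian_eq {p n : ℕ} (hn : 0 < n) (x : Config n) :
    hamiltonian p x = n * magnetization x ^ p := by
  have h : ∑ i : Fin p → Fin n, ∏ j : Fin p, spin (x (i j)) = (∑ i, spin (x i)) ^ p :=
    (Fintype.sum_pow (fun i => spin (x i)) p).symm
  have hn' : (n : ℝ) ≠ 0 := by positivity
  rw [hamiltonian, h, magnetization, div_pow, zpow_sub₀ hn']
  simp only [zpow_one, zpow_natCast]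
  ring

/-- Configurations correspond to the sets of their sites with spin `1`. -/
def configEquiv (n : ℕ) : Config n ≃ Finset (Fin n) where
  toFun x := Finset.univ.filter fun i => x i = 1
  invFun s := fun i => if i ∈ s then 1 else -1
  left_inv x := by
    funext i
    rcases Int.units_eq_one_or (x i) with h | h <;> simp [h]
  right_inv s := by
    ext i
    have : (-1 : ℤˣ) ≠ 1 := by decide
    by_cases h : i ∈ s <;> simp [h, this]

lemma sum_config (n : ℕ) (f : ℕ → ℝ) :
    ∑ x : Config n, f (plusCount x) = ∑ k ∈ Finset.range (n + 1), (n.choose k : ℝ) * f k := by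
  rw [Fintype.sum_equiv (configEquiv n) (fun x => f (plusCount x)) (fun s => f s.card)
    (fun x => rfl)]
  have := Finset.sum_powerset_apply_card (fun k => f k) (x := (Finset.univ : Finset (Fin n)))
  simpa using this

/-- The quotient of the two factorials is a product of `|j - k|` consecutive integers, all on the
same side of `k`. -/
lemma factorial_mul_pow_le (k j : ℕ) : k.factorial * k ^ j ≤ j.factorial * k ^ k := by
  rcases le_total k j with h | h
  · calc k.factorial * k ^ j = (k.factorial * k ^ (j - k)) * k ^ k := by
          rw [mul_assoc, ← pow_add, Nat.sub_add_cancel h]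
      _ ≤ _ := Nat.mul_le_mul_right _ (Nat.factorial_mul_pow_sub_le_factorial h)
  · have h1 : k.factorial ≤ j.factorial * k ^ (k - j) := by
      rw [← Nat.factorial_mul_descFactorial (Nat.sub_le k j), Nat.sub_sub_self h]
      exact Nat.mul_le_mul_left _ (Nat.descFactorial_le_pow _ _)
    calc k.factorial * k ^ j ≤ (j.factorial * k ^ (k - j)) * k ^ j := Nat.mul_le_mul_right _ h1
      _ = _ := by rw [mul_assoc, ← pow_add, Nat.sub_add_cancel h]

/-- The binomial law with success probability `k / n` has its mode at `k`. After clearing factorials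
this is `factorial_mul_pow_le` for the successes times the same for the failures. -/
lemma choose_mul_pow_le_mode {n k j : ℕ} (hk : k ≤ n) (hj : j ≤ n) :
    n.choose j * (k ^ j * (n - k) ^ (n - j)) ≤ n.choose k * (k ^ k * (n - k) ^ (n - k)) := by
  have h1 := factorial_mul_pow_le k j
  have h2 := factorial_mul_pow_le (n - k) (n - j)
  have h3 := Nat.choose_mul_factorial_mul_factorial hk
  have h4 := Nat.choose_mul_factorial_mul_factorial hj
  have hpos : 0 < k.factorial * (n - k).factorial * (j.factorial * (n - j).factorial) := by
    positivity
  refine Nat.le_of_mul_le_mul_left ?_ hpos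
  calc _ = (n.choose j * j.factorial * (n - j).factorial) *
        ((k.factorial * k ^ j) * ((n - k).factorial * (n - k) ^ (n - j))) := by ring
    _ ≤ (n.choose k * k.factorial * (n - k).factorial) *
        ((j.factorial * k ^ k) * ((n - j).factorial * (n - k) ^ (n - k))) := by
          rw [h3, h4]; exact Nat.mul_le_mul_left _ (Nat.mul_le_mul h1 h2)
    _ = _ := by ring

lemma choose_mul_pow_le {n k : ℕ} (hk : k ≤ n) :
    n.choose k * (k ^ k * (n - k) ^ (n - k)) ≤ n ^ n := by
  have h := add_pow k (n - k) n
  rw [Nat.add_sub_cancel' hk] at h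
  rw [h]
  calc _ = k ^ k * (n - k) ^ (n - k) * n.choose k := by ring
    _ ≤ _ := Finset.single_le_sum (f := fun m => k ^ m * (n - k) ^ (n - m) * n.choose m)
      (fun _ _ => Nat.zero_le _) (Finset.mem_range.2 (by omega))

/-- The expansion of `(k + (n - k)) ^ n` has `n + 1` terms, none above the modal one. With
`choose_mul_pow_le` this estimates binomial coefficients by entropy up to a factor `n + 1`, without
Stirling's formula. -/
lemma pow_le_choose_mul_pow {n k : ℕ} (hk : k ≤ n) :
    n ^ n ≤ (n + 1) * (n.choose k * (k ^ k * (n - k) ^ (n - k))) := by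
  have h := add_pow k (n - k) n
  rw [Nat.add_sub_cancel' hk] at h
  rw [h]
  calc _ ≤ ∑ _m ∈ Finset.range (n + 1), n.choose k * (k ^ k * (n - k) ^ (n - k)) := by
        refine Finset.sum_le_sum fun m hm => ?_
        rw [mul_comm]
        exact choose_mul_pow_le_mode hk (by simpa [Nat.lt_succ_iff] using hm)
    _ = _ := by simp

lemma exp_mul_log_self {a : ℝ} (k : ℕ) (ha : k ≠ 0 → 0 < a) :
    Real.exp (k * Real.log a) = a ^ k := by
  rcases eq_or_ne k 0 with rfl | h
  · simp
  · rw [Real.exp_nat_mul, Real.exp_log (ha h)]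

/-- Cleared of denominators, the identity also covers `k = 0` and `k = n`, where `0 ^ 0 = 1` matches
`0 * log 0 = 0`. -/
lemma exp_rateH_level {β : ℝ} {p n k : ℕ} (hn : 0 < n) (hk : k ≤ n) :
    Real.exp (n * rateH β p (level n k)) * ((2 : ℝ) ^ n * (k ^ k * (n - k : ℕ) ^ (n - k))) =
      Real.exp (β * (n * level n k ^ p)) * (n : ℝ) ^ n := by
  have hn' : (0 : ℝ) < n := by positivity
  have hsub : ((n - k : ℕ) : ℝ) = n - k := by push_cast [hk]; ring
  have e1 : 1 + level n k = 2 * k / n := by rw [level]; field_simp; ring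
  have e2 : 1 - level n k = 2 * (n - k : ℕ) / n := by rw [level, hsub]; field_simp; ring
  have key : Real.exp (n * ((1 / 2) * ((1 + level n k) * Real.log (1 + level n k) +
      (1 - level n k) * Real.log (1 - level n k)))) =
      (2 * k / n : ℝ) ^ k * (2 * (n - k : ℕ) / n : ℝ) ^ (n - k) := by
    rw [e1, e2, ← exp_mul_log_self k, ← exp_mul_log_self (n - k), ← Real.exp_add]
    · congr 1; field_simp
    · intro h; have : 0 < ((n - k : ℕ) : ℝ) := by exact_mod_cast Nat.pos_of_ne_zero h
      positivity
    · intro h; have : 0 < (k : ℝ) := by exact_mod_cast Nat.pos_of_ne_zero h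
      positivity
  have hnn : (n : ℝ) ^ n = (n : ℝ) ^ k * (n : ℝ) ^ (n - k) := by
    rw [← pow_add, Nat.add_sub_cancel' hk]
  have h2n : (2 : ℝ) ^ n = (2 : ℝ) ^ k * (2 : ℝ) ^ (n - k) := by
    rw [← pow_add, Nat.add_sub_cancel' hk]
  have key2 : Real.exp (n * ((1 / 2) * ((1 + level n k) * Real.log (1 + level n k) +
      (1 - level n k) * Real.log (1 - level n k)))) * (n : ℝ) ^ n =
      (2 : ℝ) ^ n * (k ^ k * (n - k : ℕ) ^ (n - k)) := by
    rw [key, hnn, h2n, div_pow, div_pow, mul_pow, mul_pow]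
    field_simp
  rw [← key2, ← mul_assoc, ← Real.exp_add]
  congr 2
  rw [rateH]; ring

lemma choose_mul_exp_le {β : ℝ} {p n k : ℕ} (hn : 0 < n) (hk : k ≤ n) :
    n.choose k * (Real.exp (β * (n * level n k ^ p)) / 2 ^ n) ≤
      Real.exp (n * rateH β p (level n k)) := by
  have h := exp_rateH_level (β := β) (p := p) hn hk
  have hc : (n.choose k : ℝ) * (k ^ k * (n - k : ℕ) ^ (n - k)) ≤ (n : ℝ) ^ n := by
    exact_mod_cast choose_mul_pow_le hk
  have hn' : (0 : ℝ) < (n : ℝ) ^ n := by positivity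
  rw [← mul_div_assoc, div_le_iff₀ (by positivity), ← mul_le_mul_iff_left₀ hn']
  calc _ = n.choose k * (Real.exp (β * (n * level n k ^ p)) * (n : ℝ) ^ n) := by ring
    _ = Real.exp (n * rateH β p (level n k)) * 2 ^ n *
        (n.choose k * (k ^ k * (n - k : ℕ) ^ (n - k))) := by rw [← h]; ring
    _ ≤ _ := mul_le_mul_of_nonneg_left hc (by positivity)

lemma exp_le_choose_mul_exp {β : ℝ} {p n k : ℕ} (hn : 0 < n) (hk : k ≤ n) :
    Real.exp (n * rateH β p (level n k)) ≤
      (n + 1) * (n.choose k * (Real.exp (β * (n * level n k ^ p)) / 2 ^ n)) := by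
  have h := exp_rateH_level (β := β) (p := p) hn hk
  have hc : (n : ℝ) ^ n ≤ (n + 1) * (n.choose k * (k ^ k * (n - k : ℕ) ^ (n - k))) := by
    exact_mod_cast pow_le_choose_mul_pow hk
  have hn' : (0 : ℝ) < (n : ℝ) ^ n := by positivity
  rw [← mul_div_assoc, ← mul_div_assoc, le_div_iff₀ (by positivity), ← mul_le_mul_iff_left₀ hn']
  calc _ ≤ Real.exp (n * rateH β p (level n k)) * 2 ^ n *
        ((n + 1) * (n.choose k * (k ^ k * (n - k : ℕ) ^ (n - k)))) :=
          mul_le_mul_of_nonneg_left hc (by positivity)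
    _ = (n + 1) * n.choose k * (Real.exp (n * rateH β p (level n k)) *
      ((2 : ℝ) ^ n * (k ^ k * (n - k : ℕ) ^ (n - k)))) := by ring
    _ = _ := by rw [h]; ring

/-! ### Large deviation bounds -/
lemma partitionFn_pos (p : ℕ) (β : ℝ) (n : ℕ) : 0 < partitionFn p β n := by
  rw [partitionFn]
  have : 0 < ∑ x : Config n, Real.exp (β * hamiltonian p x) :=
    Finset.sum_pos (fun _ _ => Real.exp_pos _) Finset.univ_nonempty
  positivity

lemma pmf_nonneg (p : ℕ) (β : ℝ) {n : ℕ} (x : Config n) : 0 ≤ pmf p β x := by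
  have := partitionFn_pos p β n
  rw [pmf]; positivity

lemma prob_mono (p : ℕ) (β : ℝ) {n : ℕ} {A B : Set (Config n)} (h : A ⊆ B) :
    prob p β n A ≤ prob p β n B := by
  classical
  refine Finset.sum_le_sum fun x _ => ?_
  have := pmf_nonneg p β x
  by_cases hA : x ∈ A
  · simp [hA, h hA]
  · by_cases hB : x ∈ B <;> simp [hA, hB, this]

lemma prob_univ (p : ℕ) (β : ℝ) (n : ℕ) : prob p β n Set.univ = 1 := by
  have := partitionFn_pos p β n
  have h2 : (2 : ℝ) ^ n * partitionFn p β n = ∑ x : Config n, Real.exp (β * hamiltonian p x) := by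
    rw [partitionFn]; field_simp
  simp only [prob, Set.mem_univ, if_true, pmf]
  rw [← Finset.sum_div, ← h2, div_self (by positivity)]

lemma prob_compl (p : ℕ) (β : ℝ) {n : ℕ} (A : Set (Config n)) :
    prob p β n Aᶜ = 1 - prob p β n A := by
  classical
  rw [← prob_univ p β n, prob, prob, prob, ← Finset.sum_sub_distrib]
  refine Finset.sum_congr rfl fun x _ => ?_
  by_cases hA : x ∈ A <;> simp [hA]

lemma prob_mul_partitionFn (p : ℕ) (β : ℝ) {n : ℕ} (hn : 0 < n) (S : Set ℕ) [DecidablePred (· ∈ S)] :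
    prob p β n {x | plusCount x ∈ S} * partitionFn p β n =
      ∑ k ∈ Finset.range (n + 1), if k ∈ S then
        n.choose k * (Real.exp (β * (n * level n k ^ p)) / 2 ^ n) else 0 := by
  have hZ := partitionFn_pos p β n
  have := sum_config n (fun k => if k ∈ S then Real.exp (β * (n * level n k ^ p)) / 2 ^ n else 0)
  rw [prob, Finset.sum_mul]
  simp only [mul_ite, mul_zero] at this
  rw [← this]
  refine Finset.sum_congr rfl fun x _ => ?_
  by_cases h : plusCount x ∈ S
  · simp only [Set.mem_ofPred_eq, h, if_true, pmf, hamiltonian_eq hn, magnetization_eq_level]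
    field_simp
  · simp [h]

/-- Upper large deviation bound. -/
lemma prob_mul_partitionFn_le {p : ℕ} {β r : ℝ} {n : ℕ} (hn : 0 < n) {A : Set (Config n)}
    (hA : ∀ x ∈ A, rateH β p (magnetization x) ≤ r) :
    prob p β n A * partitionFn p β n ≤ (n + 1) * Real.exp (n * r) := by
  classical
  have h1 : A ⊆ {x | plusCount x ∈ {k : ℕ | rateH β p (level n k) ≤ r}} := fun x hx => by
    simpa [magnetization_eq_level] using hA x hx
  calc _ ≤ _ := mul_le_mul_of_nonneg_right (prob_mono p β h1) (partitionFn_pos p β n).le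
    _ = _ := prob_mul_partitionFn p β hn _
    _ ≤ ∑ k ∈ Finset.range (n + 1), Real.exp (n * r) := by
      refine Finset.sum_le_sum fun k hk => ?_
      split_ifs with h
      · refine (choose_mul_exp_le hn (by simpa [Nat.lt_succ_iff] using hk)).trans ?_
        exact Real.exp_le_exp.2 (mul_le_mul_of_nonneg_left h (Nat.cast_nonneg n))
      · positivity
    _ = _ := by simp

/-- Lower large deviation bound. -/
lemma exp_le_prob_mul_partitionFn {p : ℕ} {β r : ℝ} {n k : ℕ} (hn : 0 < n) (hk : k ≤ n)
    {A : Set (Config n)} (hr : r ≤ rateH β p (level n k)) (hA : ∀ x, plusCount x = k → x ∈ A) :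
    Real.exp (n * r) ≤ (n + 1) * (prob p β n A * partitionFn p β n) := by
  classical
  have h1 : {x : Config n | plusCount x ∈ ({k} : Set ℕ)} ⊆ A := fun x hx => hA x (by simpa using hx)
  calc Real.exp (n * r) ≤ Real.exp (n * rateH β p (level n k)) :=
        Real.exp_le_exp.2 (mul_le_mul_of_nonneg_left hr (Nat.cast_nonneg n))
    _ ≤ _ := exp_le_choose_mul_exp hn hk
    _ = (n + 1) * (prob p β n {x | plusCount x ∈ ({k} : Set ℕ)} * partitionFn p β n) := by
      rw [prob_mul_partitionFn p β hn]
      simp [Finset.sum_ite_eq', hk]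
    _ ≤ _ := by
      refine mul_le_mul_of_nonneg_left ?_ (by positivity)
      exact mul_le_mul_of_nonneg_right (prob_mono p β h1) (partitionFn_pos p β n).le

lemma eventually_exists_level {a δ : ℝ} (ha : a ∈ Set.Icc (-1 : ℝ) 1) (hδ : 0 < δ) :
    ∀ᶠ n : ℕ in atTop, 0 < n ∧ ∃ k ≤ n, |level n k - a| < δ := by
  have h := (tendsto_natCast_atTop_atTop (R := ℝ)).eventually_gt_atTop (2 / δ)
  filter_upwards [h, eventually_gt_atTop 0] with n hn hn0
  have hn' : (0 : ℝ) < n := by positivity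
  have h0 : 0 ≤ n * (1 + a) / 2 := by have := ha.1; have : 0 ≤ 1 + a := by linarith
                                      positivity
  -- Rounding down the exact count of plus spins moves the magnetization by less than `2 / n`.
  refine ⟨hn0, ⌊n * (1 + a) / 2⌋₊, ?_, ?_⟩
  · have : n * (1 + a) / 2 ≤ n := by nlinarith [ha.2]
    exact_mod_cast (Nat.floor_le h0).trans this
  · have h1 := Nat.floor_le h0
    have h2 := Nat.lt_floor_add_one (n * (1 + a) / 2)
    set k := ⌊n * (1 + a) / 2⌋₊
    have hd : 2 < n * δ := by rwa [div_lt_iff₀ hδ] at hn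
    have : level n k - a = (2 * k - n * (1 + a)) / n := by rw [level]; field_simp; ring
    rw [this, abs_div, abs_of_pos hn', div_lt_iff₀ hn', abs_lt]
    constructor <;> nlinarith

lemma level_mem {n k : ℕ} (hn : 0 < n) (hk : k ≤ n) : level n k ∈ Set.Icc (-1 : ℝ) 1 := by
  have hn' : (0 : ℝ) < n := by positivity
  have hk' : (k : ℝ) ≤ n := by exact_mod_cast hk
  have : (0 : ℝ) ≤ k := by positivity
  rw [level]
  constructor
  · rw [le_div_iff₀ hn']; linarith
  · rw [div_le_iff₀ hn']; linarith

lemma magnetization_mem {n : ℕ} (hn : 0 < n) (x : Config n) :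
    magnetization x ∈ Set.Icc (-1 : ℝ) 1 :=
  magnetization_eq_level x ▸ level_mem hn (plusCount_le x)

/-! ### The rate function -/

/-- The real-valued function `p⁻¹ x^(1-p) artanh x`. -/
def etaReal (p : ℕ) (x : ℝ) : ℝ := (p : ℝ)⁻¹ * x ^ (1 - (p : ℤ)) * Real.artanh x

lemma mul_etaReal {p : ℕ} (hp : 3 ≤ p) {x : ℝ} (hx : x ≠ 0) :
    p * x ^ (p - 1) * etaReal p x = Real.artanh x := by
  have hp' : (p : ℝ) ≠ 0 := by positivity
  have h : x ^ (1 - (p : ℤ)) = (x ^ (p - 1))⁻¹ := by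
    rw [← zpow_natCast, ← zpow_neg]; congr 1; omega
  rw [etaReal, h]; field_simp

lemma continuous_rateH (β : ℝ) (p : ℕ) : Continuous (rateH β p) := by
  have h1 : Continuous fun x : ℝ => (1 + x) * Real.log (1 + x) :=
    Real.continuous_mul_log.comp (continuous_const.add continuous_id)
  have h2 : Continuous fun x : ℝ => (1 - x) * Real.log (1 - x) :=
    Real.continuous_mul_log.comp (continuous_const.sub continuous_id)
  exact (continuous_const.mul (continuous_pow p)).sub (continuous_const.mul (h1.add h2))

lemma artanh_eq {x : ℝ} (hx : x ∈ Set.Ioo (-1 : ℝ) 1) :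
    Real.artanh x = 1 / 2 * (Real.log (1 + x) - Real.log (1 - x)) := by
  rw [Real.artanh_eq_half_log ⟨hx.1.le, hx.2.le⟩, Real.log_div] <;> linarith [hx.1, hx.2]

lemma hasDerivAt_rateH {β : ℝ} {p : ℕ} (hp : 3 ≤ p) {x : ℝ} (hx : x ∈ Set.Ioo (-1 : ℝ) 1)
    (h0 : x ≠ 0) : HasDerivAt (rateH β p) (p * x ^ (p - 1) * (β - etaReal p x)) x := by
  have a1 : 1 + x ≠ 0 := by linarith [hx.1]
  have a2 : 1 - x ≠ 0 := by linarith [hx.2]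
  have h1 : HasDerivAt (fun x : ℝ => (1 + x) * Real.log (1 + x)) (Real.log (1 + x) + 1) x := by
    exact ((Real.hasDerivAt_mul_log a1).comp x ((hasDerivAt_id x).const_add 1)).congr_deriv (by simp)
  have h2 : HasDerivAt (fun x : ℝ => (1 - x) * Real.log (1 - x)) (-(Real.log (1 - x) + 1)) x := by
    exact ((Real.hasDerivAt_mul_log a2).comp x ((hasDerivAt_id x).const_sub 1)).congr_deriv (by simp)
  have h := ((hasDerivAt_pow p x).const_mul β).sub ((h1.add h2).const_mul (1 / 2))
  refine h.congr_deriv ?_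
  rw [mul_sub, mul_etaReal hp h0, artanh_eq hx]; ring

lemma rateH_zero (β : ℝ) {p : ℕ} (hp : 3 ≤ p) : rateH β p 0 = 0 := by
  simp [rateH, show p ≠ 0 by omega]

lemma rateH_one (β : ℝ) (p : ℕ) : rateH β p 1 = β - Real.log 2 := by
  rw [rateH]; norm_num; ring

/-- `x` is the first term of the power series of `artanh`, whose terms are nonnegative here. -/
lemma self_le_artanh {x : ℝ} (hx : x ∈ Set.Ioo (0 : ℝ) 1) : x ≤ Real.artanh x := by
  have h := Real.hasSum_log_sub_log_of_abs_lt_one (x := x) (by rw [abs_lt]; constructor <;> linarith [hx.1, hx.2])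
  have h1 := h.tsum_eq
  have h2 := h.summable.le_tsum 0 (fun k _ => by have := hx.1.le; positivity)
  rw [h1] at h2
  rw [artanh_eq ⟨by linarith [hx.1], hx.2⟩]
  norm_num at h2
  linarith

lemma hasSum_etaReal {p : ℕ} {x : ℝ} (hx : x ∈ Set.Ioo (0 : ℝ) 1) :
    HasSum (fun k : ℕ => (p : ℝ)⁻¹ * (1 / (2 * k + 1)) * x ^ (2 * (k : ℤ) + 2 - p)) (etaReal p x) := by
  have h := Real.hasSum_log_sub_log_of_abs_lt_one (x := x) (by rw [abs_lt]; constructor <;> linarith [hx.1, hx.2])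
  have h2 := (h.mul_left (1 / 2)).mul_left ((p : ℝ)⁻¹ * x ^ (1 - (p : ℤ)))
  rw [← artanh_eq ⟨by linarith [hx.1], hx.2⟩] at h2
  have e : (fun k : ℕ => (p : ℝ)⁻¹ * (1 / (2 * k + 1)) * x ^ (2 * (k : ℤ) + 2 - p)) = fun k : ℕ =>
      (p : ℝ)⁻¹ * x ^ (1 - (p : ℤ)) * (1 / 2 * (2 * (1 / (2 * k + 1)) * x ^ (2 * k + 1))) := by
    funext k
    have hz : x ^ (2 * (k : ℤ) + 2 - p) = x ^ (1 - (p : ℤ)) * x ^ (2 * k + 1) := by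
      rw [← zpow_natCast, ← zpow_add₀ hx.1.ne']; congr 1; push_cast; ring
    rw [hz]; ring
  rw [e]
  exact h2

/-- Dividing the `artanh` series by `p x ^ (p - 1)` leaves a nonnegative combination of integer
powers, possibly negative ones, each convex on the positive axis. -/
lemma convexOn_etaReal (p : ℕ) : ConvexOn ℝ (Set.Ioo (0 : ℝ) 1) (etaReal p) := by
  refine ⟨convex_Ioo 0 1, fun x hx y hy a b ha hb hab => ?_⟩
  have hxy := convex_Ioo (0 : ℝ) 1 hx hy ha hb hab
  refine hasSum_le (fun k => ?_) (hasSum_etaReal hxy)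
    (((hasSum_etaReal (p := p) hx).mul_left a).add ((hasSum_etaReal (p := p) hy).mul_left b))
  have h := (convexOn_zpow (𝕜 := ℝ) (2 * (k : ℤ) + 2 - p)).2 hx.1 hy.1 ha hb hab
  simp only [smul_eq_mul] at h ⊢
  have hc : 0 ≤ (p : ℝ)⁻¹ * (1 / (2 * k + 1)) := by positivity
  have := mul_le_mul_of_nonneg_left h hc
  linarith

lemma continuousAt_artanh {x : ℝ} (hx : x ∈ Set.Ioo (-1 : ℝ) 1) : ContinuousAt Real.artanh x := by
  have h : ContinuousAt (fun x : ℝ => 1 / 2 * (Real.log (1 + x) - Real.log (1 - x))) x := by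
    have a1 : 1 + x ≠ 0 := by linarith [hx.1]
    have a2 : 1 - x ≠ 0 := by linarith [hx.2]
    fun_prop (disch := assumption)
  refine h.congr ?_
  filter_upwards [isOpen_Ioo.mem_nhds hx] with y hy using (artanh_eq hy).symm

lemma continuousAt_etaReal (p : ℕ) {x : ℝ} (hx : x ∈ Set.Ioo (-1 : ℝ) 1) (h0 : x ≠ 0) :
    ContinuousAt (etaReal p) x :=
  (continuousAt_const.mul (continuousAt_zpow₀ x _ (Or.inl h0))).mul (continuousAt_artanh hx)

lemma exists_etaReal_gt_left {p : ℕ} (hp : 3 ≤ p) (c : ℝ) {u : ℝ} (hu : u ∈ Set.Ioo (0 : ℝ) 1) :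
    ∃ x ∈ Set.Ioo 0 u, c < etaReal p x := by
  have hp' : (0 : ℝ) < p := by positivity
  -- For `p ≥ 3`, `artanh x ≥ x` gives `η_p x ≥ 1 / (p x)`, which is at least `|c| + 1` for this
  -- choice.
  set x := min (u / 2) (1 / (p * (|c| + 1))) with hxd
  have hx0 : 0 < x := lt_min (by linarith [hu.1]) (by positivity)
  have hxu : x < u := (min_le_left _ _).trans_lt (by linarith [hu.1])
  have hx1 : x ∈ Set.Ioo (0 : ℝ) 1 := ⟨hx0, hxu.trans hu.2⟩
  refine ⟨x, ⟨hx0, hxu⟩, ?_⟩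
  have h1 : x * (p * (|c| + 1)) ≤ 1 := by
    rw [← le_div_iff₀ (by positivity)]; exact min_le_right _ _
  have h2 := self_le_artanh hx1
  rw [← mul_etaReal hp hx0.ne'] at h2
  have h3 : x ^ (p - 1) ≤ x ^ 2 := pow_le_pow_of_le_one hx0.le hx1.2.le (by omega)
  by_contra! hc
  have h4 : p * x ^ (p - 1) * etaReal p x ≤ p * x ^ 2 * |c| := by
    calc _ ≤ p * x ^ (p - 1) * |c| :=
          mul_le_mul_of_nonneg_left (hc.trans (le_abs_self c)) (by positivity)
      _ ≤ _ := by gcongr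
  have h5 : p * x * |c| < 1 := by nlinarith [mul_pos hx0 hp']
  nlinarith

/-- `artanh` is unbounded near `1` while `y ^ (p - 1) ≤ 1`. The bound is asserted all the way up to
`1` because it also gives monotonicity of the rate function there. -/
lemma exists_etaReal_gt_right {p : ℕ} (hp : 3 ≤ p) (c : ℝ) {u : ℝ} (hu : u ∈ Set.Ioo (0 : ℝ) 1) :
    ∃ x ∈ Set.Ioo u 1, ∀ y, x ≤ y → y < 1 → c < etaReal p y := by
  have hp' : (0 : ℝ) < p := by positivity
  obtain ⟨x, hx, hxy⟩ := Real.artanh_surjOn (Set.mem_univ (max (Real.artanh u + 1) (p * (|c| + 1))))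
  have hux : u < x := by
    rw [← Real.artanh_lt_artanh_iff ⟨by linarith [hu.1], hu.2⟩ hx, hxy]
    exact lt_of_lt_of_le (by linarith) (le_max_left _ _)
  refine ⟨x, ⟨hux, hx.2⟩, fun y hy hy1 => ?_⟩
  have hy0 : 0 < y := hu.1.trans (hux.trans_le hy)
  by_contra! hc
  have h1 : p * (|c| + 1) ≤ Real.artanh y :=
    (hxy ▸ le_max_right _ _ : _ ≤ Real.artanh x).trans (Real.artanh_le_artanh hx.1 hy1 hy)
  rw [← mul_etaReal hp hy0.ne'] at h1
  have h3 : y ^ (p - 1) ≤ 1 := pow_le_one₀ hy0.le hy1.le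
  have : p * y ^ (p - 1) * etaReal p y ≤ p * 1 * |c| := by
    calc _ ≤ p * y ^ (p - 1) * |c| :=
          mul_le_mul_of_nonneg_left (hc.trans (le_abs_self c)) (by positivity)
      _ ≤ _ := by gcongr
  nlinarith

/-! ### The interval where `η_p` lies below the parameter -/

/-- `(s, t)` is the set of the points of `(0, 1)` where `η_p < β`. -/
structure IsLevelPair (p : ℕ) (β s t : ℝ) : Prop where
  s_pos : 0 < s
  s_lt : s < t
  t_lt : t < 1
  eta_s : etaReal p s = β
  eta_t : etaReal p t = β
  lt_of_mem : ∀ x, s < x → x < t → etaReal p x < β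
  gt_left : ∀ x, 0 < x → x < s → β < etaReal p x
  gt_right : ∀ x, t < x → x < 1 → β < etaReal p x

/-- Convexity need not be strict: the end point with the strict inequality carries positive weight.
-/
lemma lt_of_convexOn_of_between {f : ℝ → ℝ} {S : Set ℝ} (hf : ConvexOn ℝ S f) {x y z c : ℝ}
    (hx : x ∈ S) (hz : z ∈ S) (hxy : x < y) (hyz : y < z)
    (h : f x ≤ c ∧ f z < c ∨ f x < c ∧ f z ≤ c) : f y < c := by
  have h1 : f (((z - y) / (z - x)) • x + ((y - x) / (z - x)) • z) ≤
      ((z - y) / (z - x)) • f x + ((y - x) / (z - x)) • f z :=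
    hf.2 hx hz (div_nonneg (by linarith) (by linarith)) (div_nonneg (by linarith) (by linarith))
    (by rw [← add_div, div_eq_one_iff_eq] <;> linarith)
  have hzx : 0 < z - x := by linarith
  have e : ((z - y) / (z - x)) • x + ((y - x) / (z - x)) • z = y := by
    simp only [smul_eq_mul]; field_simp; ring
  rw [e] at h1
  simp only [smul_eq_mul] at h1
  have e2 : (z - y) / (z - x) * f x + (y - x) / (z - x) * f z =
      ((z - y) * f x + (y - x) * f z) / (z - x) := by ring
  rw [e2, le_div_iff₀ hzx] at h1
  have p1 : 0 < z - y := by linarith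
  have p2 : 0 < y - x := by linarith
  rcases h with ⟨ha, hb⟩ | ⟨ha, hb⟩
  · have := mul_lt_mul_of_pos_left hb p2
    have := mul_le_mul_of_nonneg_left ha p1.le
    nlinarith
  · have := mul_le_mul_of_nonneg_left hb p2.le
    have := mul_lt_mul_of_pos_left ha p1
    nlinarith

/-- The intermediate value theorem on each side of `u` gives `s` and `t`. A value at most `β` beyond
`s` or `t` would, by convexity with `u`, force a value below `β` at `s` or `t` itself. -/
lemma exists_isLevelPair {p : ℕ} (hp : 3 ≤ p) {β u : ℝ} (hu : u ∈ Set.Ioo (0 : ℝ) 1)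
    (hβ : etaReal p u < β) : ∃ s t, IsLevelPair p β s t ∧ s < u ∧ u < t := by
  have hcvx := convexOn_etaReal p
  have hcont : ∀ a b, 0 < a → b < 1 → ContinuousOn (etaReal p) (Set.Icc a b) := fun a b ha hb x hx =>
    (continuousAt_etaReal p ⟨by linarith [hx.1], by linarith [hx.2]⟩
      (by linarith [hx.1])).continuousWithinAt
  obtain ⟨a, ha, hca⟩ := exists_etaReal_gt_left hp β hu
  obtain ⟨b, hb, hcb⟩ := exists_etaReal_gt_right hp β hu
  obtain ⟨s, hs, hse⟩ := intermediate_value_Ioo' ha.2.le (hcont a u ha.1 hu.2) ⟨hβ, hca⟩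
  obtain ⟨t, ht, hte⟩ := intermediate_value_Ioo hb.1.le (hcont u b hu.1 hb.2) ⟨hβ, hcb b le_rfl hb.2⟩
  have hs1 : s ∈ Set.Ioo (0 : ℝ) 1 := ⟨ha.1.trans hs.1, hs.2.trans hu.2⟩
  have ht1 : t ∈ Set.Ioo (0 : ℝ) 1 := ⟨hu.1.trans ht.1, ht.2.trans hb.2⟩
  refine ⟨s, t, ⟨hs1.1, hs.2.trans ht.1, ht1.2, hse, hte, ?_, ?_, ?_⟩, hs.2, ht.1⟩
  · intro x hx1 hx2
    rcases lt_trichotomy x u with h | rfl | h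
    · exact lt_of_convexOn_of_between hcvx hs1 hu hx1 h (Or.inl ⟨hse.le, hβ⟩)
    · exact hβ
    · exact lt_of_convexOn_of_between hcvx hu ht1 h hx2 (Or.inr ⟨hβ, hte.le⟩)
  · intro x hx1 hx2
    by_contra! hc
    exact (lt_of_convexOn_of_between hcvx (x := x) ⟨hx1, hx2.trans hs1.2⟩ hu hx2 hs.2
      (Or.inl ⟨hc, hβ⟩)).ne hse
  · intro x hx1 hx2
    by_contra! hc
    exact (lt_of_convexOn_of_between hcvx (z := x) hu ⟨ht1.1.trans hx1, hx2⟩ ht.1 hx1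
      (Or.inr ⟨hβ, hc⟩)).ne hte

/-! ### Shape and maximizers of the rate function -/

section
variable {p : ℕ} {β s t : ℝ}

lemma strictAntiOn_rateH (hp : 3 ≤ p) {a b : ℝ} (ha : 0 ≤ a) (hb : b ≤ 1)
    (h : ∀ x, a < x → x < b → β < etaReal p x) : StrictAntiOn (rateH β p) (Set.Icc a b) := by
  refine strictAntiOn_of_deriv_neg (convex_Icc a b) (continuous_rateH β p).continuousOn ?_
  rw [interior_Icc]
  intro x hx
  have hx0 : 0 < x := by linarith [hx.1]
  rw [(hasDerivAt_rateH hp ⟨by linarith, by linarith [hx.2]⟩ hx0.ne').deriv]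
  have := h x hx.1 hx.2
  exact mul_neg_of_pos_of_neg (by positivity) (by linarith)

lemma strictMonoOn_rateH (hp : 3 ≤ p) {a b : ℝ} (ha : 0 ≤ a) (hb : b ≤ 1)
    (h : ∀ x, a < x → x < b → etaReal p x < β) : StrictMonoOn (rateH β p) (Set.Icc a b) := by
  refine strictMonoOn_of_deriv_pos (convex_Icc a b) (continuous_rateH β p).continuousOn ?_
  rw [interior_Icc]
  intro x hx
  have hx0 : 0 < x := by linarith [hx.1]
  rw [(hasDerivAt_rateH hp ⟨by linarith, by linarith [hx.2]⟩ hx0.ne').deriv]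
  have := h x hx.1 hx.2
  exact mul_pos (by positivity) (by linarith)

lemma IsLevelPair.anti_left (h : IsLevelPair p β s t) (hp : 3 ≤ p) :
    StrictAntiOn (rateH β p) (Set.Icc 0 s) :=
  strictAntiOn_rateH hp le_rfl (h.s_lt.trans h.t_lt).le h.gt_left

lemma IsLevelPair.mono_mid (h : IsLevelPair p β s t) (hp : 3 ≤ p) :
    StrictMonoOn (rateH β p) (Set.Icc s t) :=
  strictMonoOn_rateH hp h.s_pos.le h.t_lt.le h.lt_of_mem

lemma IsLevelPair.anti_right (h : IsLevelPair p β s t) (hp : 3 ≤ p) :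
    StrictAntiOn (rateH β p) (Set.Icc t 1) :=
  strictAntiOn_rateH hp (h.s_pos.trans h.s_lt).le le_rfl h.gt_right

/-- The binary entropy part of the rate function is nonnegative. -/
lemma entropy_nonneg {x : ℝ} (hx : x ∈ Set.Icc (-1 : ℝ) 1) :
    0 ≤ (1 / 2) * ((1 + x) * Real.log (1 + x) + (1 - x) * Real.log (1 - x)) := by
  have a1 : 1 + x ∈ Set.Ici (0 : ℝ) := by simp only [Set.mem_Ici]; linarith [hx.1]
  have a2 : 1 - x ∈ Set.Ici (0 : ℝ) := by simp only [Set.mem_Ici]; linarith [hx.2]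
  have a3 : (0 : ℝ) ≤ 1 / 2 := by norm_num
  have h := Real.convexOn_mul_log.2 a1 a2 a3 a3 (by norm_num)
  simp only [smul_eq_mul] at h
  have e : (1 / 2 * (1 + x) + 1 / 2 * (1 - x)) = 1 := by ring
  rw [e, Real.log_one] at h
  linarith

lemma pow_eq_abs_pow_of_pos {x : ℝ} (h : 0 < x ^ p) : x ^ p = |x| ^ p := by
  rw [← abs_pow, abs_of_pos h]

/-- The entropy part only lowers the rate. This reduces negative `x` to `|x|`: a positive rate at `x
< 0` forces `p` to be even. -/
lemma pow_pos_of_rateH_pos (hβ : 0 ≤ β) {x : ℝ} (hx : x ∈ Set.Icc (-1 : ℝ) 1)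
    (h : 0 < rateH β p x) : 0 < x ^ p := by
  by_contra! hc
  have := entropy_nonneg hx
  rw [rateH] at h
  nlinarith

lemma rateH_eq_abs {x : ℝ} (h : 0 < x ^ p) : rateH β p x = rateH β p |x| := by
  rw [rateH, rateH, ← pow_eq_abs_pow_of_pos h]
  rcases abs_choice x with h | h <;> rw [h]
  ring_nf

lemma artanh_neg_arg {x : ℝ} (hx : x ∈ Set.Ioo (-1 : ℝ) 1) : Real.artanh (-x) = -Real.artanh x := by
  rw [artanh_eq hx, artanh_eq ⟨by linarith [hx.2], by linarith [hx.1]⟩]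
  ring_nf

lemma etaReal_eq_abs {x : ℝ} (hx : x ∈ Set.Ioo (-1 : ℝ) 1) (h : 0 < x ^ p) :
    etaReal p x = etaReal p |x| := by
  rcases le_total 0 x with h0 | h0
  · rw [abs_of_nonneg h0]
  · rw [abs_of_nonpos h0]
    have hp : Even p := by
      by_contra hc
      have := (Nat.not_even_iff_odd.1 hc).pow_nonpos h0
      linarith
    have hodd : Odd (1 - (p : ℤ)) := by
      have : Even (p : ℤ) := by exact_mod_cast hp
      exact (odd_one).sub_even this
    rw [etaReal, etaReal, artanh_neg_arg hx, hodd.neg_zpow]; ring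

lemma IsLevelPair.rateH_le (h : IsLevelPair p β s t) (hp : 3 ≤ p) {x : ℝ}
    (hx : x ∈ Set.Icc (0 : ℝ) 1) : rateH β p x ≤ max 0 (rateH β p t) := by
  rcases le_total x s with hs | hs
  · refine le_max_of_le_left ?_
    rw [← rateH_zero β hp]
    exact (h.anti_left hp).antitoneOn ⟨le_rfl, h.s_pos.le⟩ ⟨hx.1, hs⟩ hx.1
  refine le_max_of_le_right ?_
  rcases le_total x t with ht | ht
  · exact (h.mono_mid hp).monotoneOn ⟨hs, ht⟩ ⟨h.s_lt.le, le_rfl⟩ ht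
  · exact (h.anti_right hp).antitoneOn ⟨le_rfl, h.t_lt.le⟩ ⟨ht, hx.2⟩ ht

lemma IsLevelPair.rateH_lt (h : IsLevelPair p β s t) (hp : 3 ≤ p) (hpos : 0 < rateH β p t) {x : ℝ}
    (hx : x ∈ Set.Icc (0 : ℝ) 1) (hxt : x ≠ t) : rateH β p x < rateH β p t := by
  rcases le_total x s with hs | hs
  · refine lt_of_le_of_lt ?_ hpos
    rw [← rateH_zero β hp]
    exact (h.anti_left hp).antitoneOn ⟨le_rfl, h.s_pos.le⟩ ⟨hx.1, hs⟩ hx.1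
  rcases lt_or_gt_of_ne hxt with ht | ht
  · exact (h.mono_mid hp) ⟨hs, ht.le⟩ ⟨h.s_lt.le, le_rfl⟩ ht
  · exact (h.anti_right hp) ⟨le_rfl, h.t_lt.le⟩ ⟨ht.le, hx.2⟩ ht

lemma abs_mem_Icc {x : ℝ} (hx : x ∈ Set.Icc (-1 : ℝ) 1) : |x| ∈ Set.Icc (0 : ℝ) 1 :=
  ⟨abs_nonneg x, abs_le.2 hx⟩

/-- Uniqueness of the maximizer is expressed through `x ^ p`, since for even `p` both `t` and `-t`
are maximizers. -/
lemma IsLevelPair.rateH_lt_of_pow_ne (h : IsLevelPair p β s t) (hp : 3 ≤ p) (hβ : 0 ≤ β)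
    (hpos : 0 < rateH β p t) {x : ℝ} (hx : x ∈ Set.Icc (-1 : ℝ) 1) (hxt : x ^ p ≠ t ^ p) :
    rateH β p x < rateH β p t := by
  rcases le_or_gt (rateH β p x) 0 with h0 | h0
  · exact h0.trans_lt hpos
  have hxp := pow_pos_of_rateH_pos hβ hx h0
  rw [rateH_eq_abs hxp]
  refine h.rateH_lt hp hpos (abs_mem_Icc hx) ?_
  rintro rfl
  exact hxt (pow_eq_abs_pow_of_pos hxp)

/-- If the rate function takes a positive value on `[-1, 1]`, then its maximum is attained at the
right end point of the interval where `η_p < β`. -/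
lemma exists_isLevelPair_of_rateH_pos (hp : 3 ≤ p) (hβ : 0 ≤ β) {x : ℝ}
    (hx : x ∈ Set.Icc (-1 : ℝ) 1) (h : 0 < rateH β p x) :
    ∃ s t, IsLevelPair p β s t ∧ 0 < rateH β p t := by
  have hxp := pow_pos_of_rateH_pos hβ hx h
  rw [rateH_eq_abs hxp] at h
  have hx' := abs_mem_Icc hx
  have hu : ∃ u ∈ Set.Ioo (0 : ℝ) 1, etaReal p u < β := by
    -- Otherwise the rate function would be decreasing on `[0, 1]` from the value `0`, hence never
    -- positive.
    by_contra! hc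
    have : AntitoneOn (rateH β p) (Set.Icc 0 1) := by
      refine antitoneOn_of_deriv_nonpos (convex_Icc 0 1) (continuous_rateH β p).continuousOn ?_ ?_
      all_goals
        rw [interior_Icc]
        intro y hy
        have hd := hasDerivAt_rateH (β := β) hp ⟨by linarith [hy.1], hy.2⟩ hy.1.ne'
      · exact hd.differentiableAt.differentiableWithinAt
      · rw [hd.deriv]
        have := hc y hy
        have := hy.1
        exact mul_nonpos_of_nonneg_of_nonpos (by positivity) (by linarith)
    have := this ⟨le_rfl, zero_le_one⟩ hx' hx'.1
    rw [rateH_zero β hp] at this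
    linarith
  obtain ⟨u, hu, hub⟩ := hu
  obtain ⟨s, t, hst, -, -⟩ := exists_isLevelPair hp hu hub
  refine ⟨s, t, hst, ?_⟩
  have := h.trans_le (hst.rateH_le hp hx')
  simpa using this

lemma IsLevelPair.rateH_le_rateH (h : IsLevelPair p β s t) (hp : 3 ≤ p) (hβ : 0 ≤ β)
    (hpos : 0 < rateH β p t) {x : ℝ} (hx : x ∈ Set.Icc (-1 : ℝ) 1) :
    rateH β p x ≤ rateH β p t := by
  by_cases hxt : x ^ p = t ^ p
  · have ht : 0 < t := h.s_pos.trans h.s_lt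
    have hxp : 0 < x ^ p := hxt ▸ pow_pos ht p
    have : |x| = t := by
      rw [pow_eq_abs_pow_of_pos hxp] at hxt
      exact (pow_left_inj₀ (abs_nonneg x) ht.le (by omega)).1 hxt
    rw [rateH_eq_abs hxp, this]
  · exact (h.rateH_lt_of_pow_ne hp hβ hpos hx hxt).le

end

/-! ### Positivity of the rate function above the threshold -/

lemma betaStar_bddAbove (p : ℕ) :
    BddAbove {β : ℝ | 0 ≤ β ∧ sSup (rateH β p '' Set.Icc (-1) 1) = 0} := by
  -- The rate at `1` is `β - log 2` and cannot exceed a supremum equal to `0`. Boundedness matters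
  -- because the real `sSup` of an unbounded set is `0` by default.
  refine ⟨Real.log 2, fun β hβ => ?_⟩
  have hb : BddAbove (rateH β p '' Set.Icc (-1) 1) :=
    (isCompact_Icc.image (continuous_rateH β p)).bddAbove
  have := le_csSup hb ⟨1, ⟨by norm_num, le_rfl⟩, rfl⟩
  rw [hβ.2, rateH_one] at this
  linarith

lemma betaStar_nonneg {p : ℕ} (hp : 3 ≤ p) : 0 ≤ betaStar p := by
  refine le_csSup (betaStar_bddAbove p) ⟨le_rfl, ?_⟩
  refine le_antisymm (csSup_le ⟨_, 0, by norm_num, rfl⟩ ?_) (le_csSup ?_ ⟨0, by norm_num, rateH_zero 0 hp⟩)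
  · rintro _ ⟨x, hx, rfl⟩
    have := entropy_nonneg hx
    rw [rateH]; linarith
  · exact (isCompact_Icc.image (continuous_rateH 0 p)).bddAbove

lemma exists_rateH_pos_of_betaStar_lt {p : ℕ} (hp : 3 ≤ p) {β : ℝ} (h : betaStar p < β) :
    ∃ x ∈ Set.Icc (-1 : ℝ) 1, 0 < rateH β p x := by
  by_contra! hc
  have hβ : 0 ≤ β := (betaStar_nonneg hp).trans h.le
  have hb : BddAbove (rateH β p '' Set.Icc (-1) 1) :=
    (isCompact_Icc.image (continuous_rateH β p)).bddAbove
  refine h.not_ge (le_csSup (betaStar_bddAbove p) ⟨hβ, le_antisymm ?_ ?_⟩)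
  · refine csSup_le ⟨_, 0, by norm_num, rfl⟩ ?_
    rintro _ ⟨x, hx, rfl⟩
    exact hc x hx
  · exact le_csSup hb ⟨0, by norm_num, rateH_zero β hp⟩

/-- At `β = log 2` the value at `1` is only `0`, but the rate function is strictly decreasing near
`1`, so it is positive just before. -/
lemma exists_rateH_pos_of_log_two_le {p : ℕ} (hp : 3 ≤ p) {β : ℝ} (h : Real.log 2 ≤ β) :
    ∃ x ∈ Set.Icc (-1 : ℝ) 1, 0 < rateH β p x := by
  by_contra! hc
  have h1 : 0 ≤ rateH β p 1 := by rw [rateH_one]; linarith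
  have hhalf : (1 / 2 : ℝ) ∈ Set.Ioo (0 : ℝ) 1 := by norm_num
  obtain ⟨x, hx, hxc⟩ := exists_etaReal_gt_right hp β hhalf
  have ha : StrictAntiOn (rateH β p) (Set.Icc x 1) :=
    strictAntiOn_rateH hp (by linarith [hx.1]) le_rfl fun y hy hy1 => hxc y hy.le hy1
  have := ha ⟨le_rfl, hx.2.le⟩ ⟨hx.2.le, le_rfl⟩ hx.2
  have := hc x ⟨by linarith [hx.1], hx.2.le⟩
  linarith

/-! ### Maximizers -/

/-- `f` is a decreasing function of a convex function whose derivative is `g'`. -/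
structure IsConcaveProfile (f g' : ℝ → ℝ) : Prop where
  continuous : Continuous f
  bdd : BddAbove (Set.range f)
  mono : Monotone g'
  anti_of_pos : ∀ b, 0 < g' b → StrictAntiOn f (Set.Ici b)
  mono_of_neg : ∀ b, g' b < 0 → StrictMonoOn f (Set.Iic b)
  anti_of_nonneg : ∀ b, 0 ≤ g' b → AntitoneOn f (Set.Ici b)

lemma isConcaveProfile {f g g' F : ℝ → ℝ} (hg : ∀ b, HasDerivAt g (g' b) b) (hmono : Monotone g')
    (hF : ∀ b, f b = F (g b)) (hFa : StrictAntiOn F (Set.range g)) (hc : Continuous f)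
    (hb : BddAbove (Set.range f)) : IsConcaveProfile f g' := by
  have hgc : Continuous g := continuous_iff_continuousAt.2 fun b => (hg b).continuousAt
  refine ⟨hc, hb, hmono, fun b hb x hx y hy hxy => ?_, fun b hb x hx y hy hxy => ?_,
    fun b hb x hx y hy hxy => ?_⟩
  · rw [hF, hF]
    refine hFa ⟨x, rfl⟩ ⟨y, rfl⟩ ?_
    refine strictMonoOn_of_deriv_pos (convex_Ici b) hgc.continuousOn (fun z hz => ?_) hx hy hxy
    rw [interior_Ici] at hz
    rw [(hg z).deriv]
    exact hb.trans_le (hmono (le_of_lt hz))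
  · rw [hF, hF]
    refine hFa ⟨y, rfl⟩ ⟨x, rfl⟩ ?_
    refine strictAntiOn_of_deriv_neg (convex_Iic b) hgc.continuousOn (fun z hz => ?_) hx hy hxy
    rw [interior_Iic] at hz
    rw [(hg z).deriv]
    exact (hmono (le_of_lt hz)).trans_lt hb
  · rw [hF, hF]
    refine hFa.antitoneOn ⟨x, rfl⟩ ⟨y, rfl⟩ ?_
    refine monotoneOn_of_deriv_nonneg (convex_Ici b) hgc.continuousOn
      (fun z _ => (hg z).differentiableAt.differentiableWithinAt) (fun z hz => ?_) hx hy hxy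
    rw [interior_Ici] at hz
    rw [(hg z).deriv]
    exact hb.trans (hmono (le_of_lt hz))

lemma IsConcaveProfile.argmax_le {f g' : ℝ → ℝ} (h : IsConcaveProfile f g') {b : ℝ}
    (hb : 0 < g' b) : argmax f ≤ (b : EReal) := by
  have ha := h.anti_of_pos b hb
  refine sSup_le ?_
  rintro θ (⟨c, rfl, hc⟩ | ⟨rfl, ht⟩ | ⟨rfl, -⟩)
  · rw [EReal.coe_le_coe_iff]
    by_contra! hbc
    exact (ha (Set.mem_Ici.2 le_rfl) (Set.mem_Ici.2 hbc.le) hbc).not_ge (hc b)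
  · exfalso
    have h1 : f (b + 1) < f b := ha (Set.mem_Ici.2 le_rfl) (Set.mem_Ici.2 (by linarith)) (by linarith)
    -- A maximizer `⊤` would make the supremum a limit at infinity, which lies below `f b`.
    have h2 : (⨆ y, f y) ≤ f (b + 1) := by
      refine le_of_tendsto ht ?_
      filter_upwards [eventually_ge_atTop (b + 1)] with c hc
      exact ha.antitoneOn (Set.mem_Ici.2 (by linarith)) (Set.mem_Ici.2 (by linarith)) hc
    exact (h1.trans_le (le_ciSup h.bdd b)).not_ge h2
  · exact bot_le

/-- As `argmax` is a supremum of maximizers, some maximizer beyond `b` must be exhibited: a point of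
a compact interval if `g'` becomes nonnegative, and `⊤` if `f` increases forever. -/
lemma IsConcaveProfile.le_argmax {f g' : ℝ → ℝ} (h : IsConcaveProfile f g') {b : ℝ}
    (hb : g' b < 0) : (b : EReal) ≤ argmax f := by
  have hm := (h.mono_of_neg b hb).monotoneOn
  by_cases hex : ∃ c, 0 ≤ g' c
  · obtain ⟨c, hc⟩ := hex
    have hbc : b ≤ c := by
      by_contra! hlt
      linarith [h.mono hlt.le]
    obtain ⟨a, ha, hmax⟩ := isCompact_Icc.exists_isMaxOn ⟨b, le_rfl, hbc⟩
      h.continuous.continuousOn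
    have hglob : ∀ y, f y ≤ f a := fun y => by
      rcases le_total y b with hy | hy
      · exact (hm hy (Set.mem_Iic.2 le_rfl) hy).trans (hmax ⟨le_rfl, hbc⟩)
      rcases le_total y c with hy' | hy'
      · exact hmax ⟨hy, hy'⟩
      · exact (h.anti_of_nonneg c hc (Set.mem_Ici.2 le_rfl) hy' hy').trans (hmax ⟨hbc, le_rfl⟩)
    exact (EReal.coe_le_coe_iff.2 ha.1).trans (le_sSup (Or.inl ⟨a, rfl, hglob⟩))
  · push Not at hex
    have hmono : Monotone f := fun x y hxy =>
      (h.mono_of_neg y (hex y)).monotoneOn hxy (Set.mem_Iic.2 le_rfl) hxy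
    have : IsMaximizer f ⊤ := Or.inr (Or.inl ⟨rfl, tendsto_atTop_ciSup hmono h.bdd⟩)
    exact le_top.trans (le_sSup this)

/-! ### The maximum likelihood estimator -/

section MLE
variable {ι : Type*} [Fintype ι] (H : ι → ℝ)

/-- The derivative of `∑ exp (b (H y - h))` with respect to `b`. -/
def tiltDeriv (h b : ℝ) : ℝ := ∑ y, (H y - h) * Real.exp (b * (H y - h))

lemma hasDerivAt_tilt (h b : ℝ) :
    HasDerivAt (fun b => ∑ y, Real.exp (b * (H y - h))) (tiltDeriv H h b) b := by
  refine HasDerivAt.fun_sum fun y _ => ?_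
  have := ((hasDerivAt_id b).mul_const (H y - h)).exp
  refine this.congr_deriv ?_
  simp [mul_comm]

lemma monotone_mul_exp (c : ℝ) : Monotone fun b : ℝ => c * Real.exp (b * c) := by
  intro a b hab
  rcases le_total 0 c with hc | hc
  · exact mul_le_mul_of_nonneg_left (Real.exp_le_exp.2 (mul_le_mul_of_nonneg_right hab hc)) hc
  · exact mul_le_mul_of_nonpos_left (Real.exp_le_exp.2 (mul_le_mul_of_nonpos_right hab hc)) hc

lemma monotone_tiltDeriv (h : ℝ) : Monotone (tiltDeriv H h) := fun _ _ hab =>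
  Finset.sum_le_sum fun y _ => monotone_mul_exp (H y - h) hab

/-- The mean of `H` under the weights `exp (b H)`. -/
def tiltMean (b : ℝ) : ℝ := (∑ y, H y * Real.exp (b * H y)) / ∑ y, Real.exp (b * H y)

lemma tiltMean_neg (b : ℝ) : tiltMean (fun y => -H y) b = -tiltMean H (-b) := by
  simp only [tiltMean, mul_neg, neg_mul, Finset.sum_neg_distrib, neg_div]

variable [Nonempty ι]

/-- The likelihood equation: the score has the sign of the model mean of `H` minus its observed
value. -/
lemma tiltDeriv_eq (h b : ℝ) :
    tiltDeriv H h b = (tiltMean H b - h) * ∑ y, Real.exp (b * (H y - h)) := by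
  have hpos : 0 < ∑ y, Real.exp (b * H y) :=
    Finset.sum_pos (fun _ _ => Real.exp_pos _) Finset.univ_nonempty
  have e : ∀ y, Real.exp (b * (H y - h)) = Real.exp (b * H y) * Real.exp (-(b * h)) := fun y => by
    rw [← Real.exp_add]; congr 1; ring
  simp only [tiltDeriv, e, ← Finset.sum_mul, tiltMean]
  rw [sub_mul, ← mul_assoc, div_mul_cancel₀ _ hpos.ne', ← mul_assoc, ← sub_mul, Finset.mul_sum,
    ← Finset.sum_sub_distrib, Finset.sum_mul]
  exact Finset.sum_congr rfl fun y _ => by ring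

lemma tilt_pos (h b : ℝ) : 0 < ∑ y, Real.exp (b * (H y - h)) :=
  Finset.sum_pos (fun _ _ => Real.exp_pos _) Finset.univ_nonempty

lemma tiltDeriv_pos_iff {h b : ℝ} : 0 < tiltDeriv H h b ↔ h < tiltMean H b := by
  rw [tiltDeriv_eq, mul_pos_iff_of_pos_right (tilt_pos H h b), sub_pos]

lemma tiltDeriv_neg_iff {h b : ℝ} : tiltDeriv H h b < 0 ↔ tiltMean H b < h := by
  rw [tiltDeriv_eq, ← sub_neg (b := h)]
  exact ⟨fun h1 => by_contra fun h2 => h1.not_ge (mul_nonneg (not_lt.1 h2) (tilt_pos H h b).le),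
    fun h1 => mul_neg_of_neg_of_pos h1 (tilt_pos H h b)⟩

lemma continuous_tiltMean : Continuous (tiltMean H) := by
  refine Continuous.div (by fun_prop) (by fun_prop) fun b => ?_
  exact (Finset.sum_pos (fun _ _ => Real.exp_pos _) Finset.univ_nonempty).ne'

lemma exists_lt_tiltMean {h : ℝ} {y₀ : ι} (hy : h < H y₀) : ∃ b, h < tiltMean H b := by
  classical
  set c := H y₀ - h with hcd
  have hc : 0 < c := by linarith
  set K := ∑ y, |H y - h| with hK
  have hK0 : 0 ≤ K := Finset.sum_nonneg fun _ _ => abs_nonneg _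
  -- Since `exp z ≥ z + 1`, the term of `y₀` is at least `c + K + 1`, while the other terms sum to
  -- at least `-K`.
  refine ⟨(K + 1) / c ^ 2, (tiltDeriv_pos_iff H).1 ?_⟩
  set b := (K + 1) / c ^ 2
  have hb : 0 < b := by positivity
  have hterm : ∀ y, -|H y - h| ≤ (H y - h) * Real.exp (b * (H y - h)) := fun y => by
    rcases le_total 0 (H y - h) with h0 | h0
    · have : 0 ≤ (H y - h) * Real.exp (b * (H y - h)) := by positivity
      linarith [abs_nonneg (H y - h)]
    · rw [abs_of_nonpos h0, neg_neg]
      have : Real.exp (b * (H y - h)) ≤ 1 :=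
        Real.exp_le_one_iff.2 (mul_nonpos_of_nonneg_of_nonpos hb.le h0)
      nlinarith
  rw [tiltDeriv, ← Finset.add_sum_erase _ _ (Finset.mem_univ y₀)]
  have h1 : -K ≤ ∑ y ∈ Finset.univ.erase y₀, (H y - h) * Real.exp (b * (H y - h)) := by
    calc -K ≤ -∑ y ∈ Finset.univ.erase y₀, |H y - h| := by
          refine neg_le_neg (Finset.sum_le_sum_of_subset_of_nonneg (Finset.erase_subset _ _) ?_)
          exact fun _ _ _ => abs_nonneg _
      _ = ∑ y ∈ Finset.univ.erase y₀, -|H y - h| := by rw [Finset.sum_neg_distrib]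
      _ ≤ _ := Finset.sum_le_sum fun y _ => hterm y
  have h2 : K + 1 < c * Real.exp (b * c) := by
    have e1 : b * c + 1 ≤ Real.exp (b * c) := Real.add_one_le_exp _
    have e2 : c * (b * c) = K + 1 := by simp only [b]; field_simp
    nlinarith
  linarith

lemma exists_tiltMean_lt {h : ℝ} {y₀ : ι} (hy : H y₀ < h) : ∃ b, tiltMean H b < h := by
  obtain ⟨b, hb⟩ := exists_lt_tiltMean (fun y => -H y) (h := -h) (y₀ := y₀) (by linarith)
  rw [tiltMean_neg] at hb
  exact ⟨-b, by linarith⟩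

/-- Two parameters, not one, are needed: they separate the maximizers belonging to `H x` and `H y`
strictly. The second one comes from continuity. -/
lemma exists_tiltMean_mem {x y : ι} (hxy : H x < H y) :
    ∃ b₁ b₂, b₁ < b₂ ∧ tiltMean H b₁ ∈ Set.Ioo (H x) (H y) ∧ tiltMean H b₂ ∈ Set.Ioo (H x) (H y) := by
  have hc := continuous_tiltMean H
  have hex : ∃ b, tiltMean H b ∈ Set.Ioo (H x) (H y) := by
    obtain ⟨b₁, h1⟩ := exists_lt_tiltMean H hxy
    obtain ⟨b₂, h2⟩ := exists_tiltMean_lt H hxy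
    set v := (H x + H y) / 2 with hv
    rcases le_or_gt (tiltMean H b₁) v with h3 | h3
    · exact ⟨b₁, h1, by linarith⟩
    rcases le_or_gt v (tiltMean H b₂) with h4 | h4
    · exact ⟨b₂, by linarith, h2⟩
    obtain ⟨b, hb⟩ := mem_range_of_exists_le_of_exists_ge hc ⟨b₂, h4.le⟩ ⟨b₁, h3.le⟩
    exact ⟨b, by rw [hb]; constructor <;> linarith⟩
  obtain ⟨b, hb⟩ := hex
  have hopen : ∀ᶠ c in 𝓝 b, tiltMean H c ∈ Set.Ioo (H x) (H y) :=
    hc.continuousAt.eventually (isOpen_Ioo.mem_nhds hb)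
  obtain ⟨ε, hε, hball⟩ := Metric.eventually_nhds_iff.1 hopen
  refine ⟨b, b + ε / 2, by linarith, hb, hball ?_⟩
  rw [Real.dist_eq, add_sub_cancel_left, abs_of_pos (by linarith)]
  linarith

lemma isConcaveProfile_inv_tilt {h : ℝ} {f : ℝ → ℝ} (y₀ : ι) (hy : H y₀ = h)
    (hf : ∀ b, f b = (∑ y, Real.exp (b * (H y - h)))⁻¹) : IsConcaveProfile f (tiltDeriv H h) := by
  have hpos := tilt_pos H h
  refine isConcaveProfile (F := fun z => z⁻¹) (hasDerivAt_tilt H h) (monotone_tiltDeriv H h) hf ?_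
    ?_ ⟨1, ?_⟩
  · rintro _ ⟨a, rfl⟩ _ ⟨b, rfl⟩ hab
    exact inv_strictAnti₀ (hpos a) hab
  · rw [funext hf]
    exact Continuous.inv₀ (by fun_prop) fun b => (hpos b).ne'
  · rintro _ ⟨b, rfl⟩
    rw [hf]
    refine inv_le_one_of_one_le₀ ?_
    have := Finset.single_le_sum (f := fun y => Real.exp (b * (H y - h)))
      (fun _ _ => (Real.exp_pos _).le) (Finset.mem_univ y₀)
    simpa [hy] using this

lemma argmax_inv_tilt_lt {x y : ι} (hxy : H x < H y) {fx fy : ℝ → ℝ}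
    (hx : ∀ b, fx b = (∑ z, Real.exp (b * (H z - H x)))⁻¹)
    (hy : ∀ b, fy b = (∑ z, Real.exp (b * (H z - H y)))⁻¹) : argmax fx < argmax fy := by
  obtain ⟨b₁, b₂, hb, h1, h2⟩ := exists_tiltMean_mem H hxy
  calc argmax fx ≤ (b₁ : EReal) :=
        (isConcaveProfile_inv_tilt H x rfl hx).argmax_le ((tiltDeriv_pos_iff H).2 h1.1)
    _ < (b₂ : EReal) := EReal.coe_lt_coe_iff.2 hb
    _ ≤ argmax fy := (isConcaveProfile_inv_tilt H y rfl hy).le_argmax ((tiltDeriv_neg_iff H).2 h2.2)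

end MLE

lemma pmf_eq (p : ℕ) (b : ℝ) {n : ℕ} (x : Config n) :
    pmf p b x = (∑ y : Config n, Real.exp (b * (hamiltonian p y - hamiltonian p x)))⁻¹ := by
  have h : ∀ y : Config n, Real.exp (b * (hamiltonian p y - hamiltonian p x)) =
      Real.exp (b * hamiltonian p y) / Real.exp (b * hamiltonian p x) := fun y => by
    rw [← Real.exp_sub]; congr 1; ring
  have h2 : (2 : ℝ) ^ n * partitionFn p b n = ∑ x : Config n, Real.exp (b * hamiltonian p x) := by
    rw [partitionFn]; field_simp
  simp only [h]
  rw [pmf, h2, ← Finset.sum_div, inv_div]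

lemma mle_lt_mle {p n : ℕ} {x y : Config n} (h : hamiltonian p x < hamiltonian p y) :
    mle p n x < mle p n y :=
  argmax_inv_tilt_lt (fun z : Config n => hamiltonian p z) h (fun b => pmf_eq p b x)
    (fun b => pmf_eq p b y)

/-- Only the order of the estimates enters the `p`-value, so no formula for the likelihood estimator
is required. -/
lemma mle_lt_mle_iff {p n : ℕ} (hn : 0 < n) {x y : Config n} :
    mle p n x < mle p n y ↔ magnetization x ^ p < magnetization y ^ p := by
  have hn' : (0 : ℝ) < n := by positivity
  have key : ∀ x y : Config n, hamiltonian p x < hamiltonian p y ↔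
      magnetization x ^ p < magnetization y ^ p := fun x y => by
    rw [hamiltonian_eq hn, hamiltonian_eq hn, mul_lt_mul_iff_right₀ hn']
  rw [← key]
  refine ⟨fun h => ?_, mle_lt_mle⟩
  by_contra! hc
  rcases hc.lt_or_eq with hlt | heq
  · exact (mle_lt_mle hlt).not_gt h
  · refine h.ne ?_
    simp only [mle, pmf_eq, heq]

/-! ### The maximum pseudolikelihood estimator -/

/-- The configuration `x` with its `i`-th spin flipped. -/
def flip {n : ℕ} (x : Config n) (i : Fin n) : Config n := Function.update x i (-x i)

lemma condProb_eq (p : ℕ) (b : ℝ) {n : ℕ} (x : Config n) (i : Fin n) :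
    condProb p b x i =
      (1 + Real.exp (-(b * (hamiltonian p x - hamiltonian p (flip x i)))))⁻¹ := by
  have hZ := partitionFn_pos p b n
  have hsum : ∑ s : ℤˣ, pmf p b (Function.update x i s) = pmf p b x + pmf p b (flip x i) := by
    have hu : (Finset.univ : Finset ℤˣ) = {x i, -x i} := by
      ext s
      rcases Int.units_eq_one_or s with rfl | rfl <;>
        rcases Int.units_eq_one_or (x i) with h | h <;> simp [h]
    have hne : x i ≠ -x i := by
      rcases Int.units_eq_one_or (x i) with h | h <;> rw [h] <;> decide
    rw [hu, Finset.sum_pair hne, Function.update_eq_self, flip]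
  rw [condProb, hsum, pmf, pmf]
  have e : Real.exp (-(b * (hamiltonian p x - hamiltonian p (flip x i)))) =
      Real.exp (b * hamiltonian p (flip x i)) / Real.exp (b * hamiltonian p x) := by
    rw [← Real.exp_sub]; congr 1; ring
  rw [e]
  have := Real.exp_pos (b * hamiltonian p x)
  have := Real.exp_pos (b * hamiltonian p (flip x i))
  field_simp

/-- The derivative of minus the logarithm of a product of logistic functions. -/
def logisticDeriv {ι : Type*} [Fintype ι] (c : ι → ℝ) (b : ℝ) : ℝ :=
  ∑ i, -c i / (1 + Real.exp (b * c i))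

lemma isConcaveProfile_logistic {ι : Type*} [Fintype ι] {c : ι → ℝ} {f : ℝ → ℝ}
    (hf : ∀ b, f b = ∏ i, (1 + Real.exp (-(b * c i)))⁻¹) :
    IsConcaveProfile f (logisticDeriv c) := by
  have hpos : ∀ z : ℝ, 0 < 1 + Real.exp z := fun z => by positivity
  refine isConcaveProfile (g := fun b => ∑ i, Real.log (1 + Real.exp (-(b * c i))))
    (F := fun z => Real.exp (-z)) (fun b => ?_) (fun a b hab => ?_) (fun b => ?_) ?_ ?_ ⟨1, ?_⟩
  · refine HasDerivAt.fun_sum fun i _ => ?_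
    have h1 : HasDerivAt (fun b => 1 + Real.exp (-(b * c i))) (Real.exp (-(b * c i)) * -c i) b := by
      refine HasDerivAt.const_add 1 (HasDerivAt.exp ?_)
      exact ((hasDerivAt_id b).mul_const (c i)).neg.congr_deriv (by simp)
    refine (h1.log (hpos _).ne').congr_deriv ?_
    rw [Real.exp_neg]
    have := Real.exp_pos (b * c i)
    field_simp
    ring
  · refine Finset.sum_le_sum fun i _ => ?_
    rcases le_total 0 (c i) with hc | hc
    · rw [neg_div, neg_div, neg_le_neg_iff]
      exact div_le_div_of_nonneg_left hc (hpos _)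
        (by have := Real.exp_le_exp.2 (mul_le_mul_of_nonneg_right hab hc); linarith)
    · exact div_le_div_of_nonneg_left (by linarith) (hpos _)
        (by have := Real.exp_le_exp.2 (mul_le_mul_of_nonpos_right hab hc); linarith)
  · rw [hf, ← Finset.sum_neg_distrib, Real.exp_sum]
    exact Finset.prod_congr rfl fun i _ => by rw [Real.exp_neg (Real.log _), Real.exp_log (hpos _)]
  · exact fun a _ b _ hab => Real.exp_lt_exp.2 (neg_lt_neg hab)
  · rw [funext hf]
    exact continuous_finsetProd _ fun i _ => Continuous.inv₀ (by fun_prop) fun b => (hpos _).ne'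
  · rintro _ ⟨b, rfl⟩
    rw [hf]
    refine Finset.prod_le_one (fun i _ => (inv_pos.2 (hpos _)).le) fun i _ => ?_
    exact inv_le_one_of_one_le₀ (by linarith [Real.exp_pos (-(b * c i))])

/-- The estimator converges to `η_p (x₀)` along samples whose magnetization converges to `x₀`. -/
def TracksEta (p : ℕ) (est : Estimator) : Prop :=
  ∀ x₀ ∈ Set.Ioo (-1 : ℝ) 1, x₀ ≠ 0 → ∀ c : ℝ,
    (c < etaReal p x₀ → ∃ δ > 0, ∀ᶠ n : ℕ in atTop, ∀ x : Config n,
      |magnetization x - x₀| < δ → (c : EReal) < est n x) ∧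
    (etaReal p x₀ < c → ∃ δ > 0, ∀ᶠ n : ℕ in atTop, ∀ x : Config n,
      |magnetization x - x₀| < δ → est n x < (c : EReal))

lemma eta_eq {p : ℕ} {x : ℝ} (hx : x ∈ Set.Ioo (-1 : ℝ) 1) (h0 : x ≠ 0) :
    eta p x = (etaReal p x : EReal) := by
  rw [eta, if_neg h0, if_neg hx.2.ne, if_neg hx.1.ne']; rfl

lemma tracksEta_mpleClosedForm (p : ℕ) : TracksEta p (mpleClosedForm p) := by
  intro x₀ hx₀ h0 c
  have hopen : ∀ᶠ x in 𝓝 x₀, x ∈ Set.Ioo (-1 : ℝ) 1 ∧ x ≠ 0 :=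
    Filter.Eventually.and (isOpen_Ioo.mem_nhds hx₀) (isOpen_ne.mem_nhds h0)
  have hc := continuousAt_etaReal p hx₀ h0
  constructor
  · intro hlt
    obtain ⟨δ, hδ, h⟩ := Metric.eventually_nhds_iff.1 (hopen.and (hc.eventually (lt_mem_nhds hlt)))
    refine ⟨δ, hδ, Eventually.of_forall fun n x hx => ?_⟩
    obtain ⟨⟨h1, h2⟩, h3⟩ := h (y := magnetization x) (by rwa [Real.dist_eq])
    rw [mpleClosedForm, eta_eq h1 h2]
    exact EReal.coe_lt_coe_iff.2 h3
  · intro hlt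
    obtain ⟨δ, hδ, h⟩ := Metric.eventually_nhds_iff.1 (hopen.and (hc.eventually (gt_mem_nhds hlt)))
    refine ⟨δ, hδ, Eventually.of_forall fun n x hx => ?_⟩
    obtain ⟨⟨h1, h2⟩, h3⟩ := h (y := magnetization x) (by rwa [Real.dist_eq])
    rw [mpleClosedForm, eta_eq h1 h2]
    exact EReal.coe_lt_coe_iff.2 h3

/-! ### The pseudolikelihood score and its large-sample limit -/

/-- Twice the divided difference of `x ^ p` at `m` and `m - h`. -/
def powSlope (p : ℕ) (h m : ℝ) : ℝ := 2 * ∑ i ∈ Finset.range p, m ^ i * (m - h) ^ (p - 1 - i)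

lemma powSlope_mul (p : ℕ) (h m : ℝ) : powSlope p h m * h = 2 * (m ^ p - (m - h) ^ p) := by
  have := (Commute.all m (m - h)).geom_sum₂_mul p
  rw [sub_sub_cancel] at this
  rw [powSlope, mul_assoc, this]

lemma powSlope_zero (p : ℕ) (m : ℝ) : powSlope p 0 m = 2 * p * m ^ (p - 1) := by
  have : ∀ i ∈ Finset.range p, m ^ i * (m - 0) ^ (p - 1 - i) = m ^ (p - 1) := fun i hi => by
    rw [sub_zero, ← pow_add]; congr 1; have := Finset.mem_range.1 hi; omega
  rw [powSlope, Finset.sum_congr rfl this]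
  simp; ring

lemma magnetization_flip {n : ℕ} (x : Config n) (i : Fin n) :
    magnetization (flip x i) = magnetization x - 2 / n * spin (x i) := by
  have h : ∑ j, spin (flip x i j) - ∑ j, spin (x j) = -2 * spin (x i) := by
    rw [← Finset.sum_sub_distrib, Finset.sum_eq_single i]
    · simp [flip, spin]; ring
    · intro j _ hj; simp [flip, Function.update_of_ne hj]
    · simp
  rw [magnetization, magnetization, show ∑ j, spin (flip x i j) = ∑ j, spin (x j) - 2 * spin (x i) by
    linarith]
  ring

lemma hamiltonian_sub_flip {p n : ℕ} (hn : 0 < n) (x : Config n) (i : Fin n) :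
    hamiltonian p x - hamiltonian p (flip x i) =
      spin (x i) * powSlope p (2 / n * spin (x i)) (magnetization x) := by
  have hn' : (n : ℝ) ≠ 0 := by positivity
  have h := powSlope_mul p (2 / n * spin (x i)) (magnetization x)
  rw [hamiltonian_eq hn, hamiltonian_eq hn, magnetization_flip, ← mul_sub]
  have h2 : spin (x i) * spin (x i) = 1 := by
    rcases Int.units_eq_one_or (x i) with h | h <;> rw [h] <;> norm_num [spin]
  set Q := powSlope p (2 / n * spin (x i)) (magnetization x)
  have h3 : magnetization x ^ p - (magnetization x - 2 / n * spin (x i)) ^ p =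
      Q * (1 / n * spin (x i)) := by
    have : Q * (1 / n * spin (x i)) = Q * (2 / n * spin (x i)) / 2 := by ring
    rw [this, h]; ring
  rw [h3]; field_simp

lemma sum_spin_fun {n : ℕ} (x : Config n) (F : ℤˣ → ℝ) :
    ∑ i, F (x i) = plusCount x * F 1 + (n - plusCount x) * F (-1) := by
  have : ∀ i, F (x i) = (if x i = 1 then (1 : ℝ) else 0) * (F 1 - F (-1)) + F (-1) := fun i => by
    rcases Int.units_eq_one_or (x i) with h | h
    · simp [h]
    · have : (-1 : ℤˣ) ≠ 1 := by decide
      simp [h, this]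
  simp only [this, Finset.sum_add_distrib, ← Finset.sum_mul, plusCount]
  simp
  ring

/-- The normalized derivative of minus the logarithm of the pseudolikelihood. -/
def pseudoScore (p : ℕ) (b h m : ℝ) : ℝ :=
  -((1 + m) / 2 * (powSlope p h m / (1 + Real.exp (b * powSlope p h m)))) +
    (1 - m) / 2 * (powSlope p (-h) m / (1 + Real.exp (-(b * powSlope p (-h) m))))

lemma logisticDeriv_eq {p n : ℕ} (hn : 0 < n) (x : Config n) (b : ℝ) :
    logisticDeriv (fun i => hamiltonian p x - hamiltonian p (flip x i)) b =
      n * pseudoScore p b (2 / n) (magnetization x) := by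
  have hn' : (n : ℝ) ≠ 0 := by positivity
  have hs : spin 1 = 1 := by norm_num [spin]
  have hs' : spin (-1) = -1 := by norm_num [spin]
  simp only [logisticDeriv, hamiltonian_sub_flip hn]
  rw [sum_spin_fun x (fun s => -(spin s * powSlope p (2 / n * spin s) (magnetization x)) /
    (1 + Real.exp (b * (spin s * powSlope p (2 / n * spin s) (magnetization x)))))]
  have hk : (plusCount x : ℝ) = n * (1 + magnetization x) / 2 := by
    rw [magnetization_eq_level, level]; field_simp; ring
  simp only [hs, hs', hk, pseudoScore]
  simp only [one_mul, mul_one, mul_neg, neg_mul, neg_neg]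
  ring

/-- Joint continuity up to `h = 0` disposes of the finite-sample correction: with `h = 2 / n` the
exact score converges to that of the closed form. -/
lemma continuous_pseudoScore (p : ℕ) (b : ℝ) :
    Continuous fun z : ℝ × ℝ => pseudoScore p b z.1 z.2 := by
  have h1 : Continuous fun z : ℝ × ℝ => powSlope p z.1 z.2 := by unfold powSlope; fun_prop
  have h2 : Continuous fun z : ℝ × ℝ => powSlope p (-z.1) z.2 :=
    h1.comp (continuous_fst.neg.prodMk continuous_snd)
  unfold pseudoScore
  have hpos : ∀ z : ℝ, 1 + Real.exp z ≠ 0 := fun z => by positivity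
  refine Continuous.add (Continuous.neg (Continuous.mul (by fun_prop) (h1.div ?_ fun z => hpos _)))
    (Continuous.mul (by fun_prop) (h2.div ?_ fun z => hpos _))
  · fun_prop
  · fun_prop

/-- The limiting score has the sign of `b - η_p x`, because `exp (2 artanh x) = (1 + x) / (1 - x)`.
The factor `x ^ (p - 1)` keeps this sign right when that power is negative. -/
lemma pseudoScore_zero {p : ℕ} (hp : 3 ≤ p) (b : ℝ) {x : ℝ} (hx : x ∈ Set.Ioo (-1 : ℝ) 1)
    (h0 : x ≠ 0) :
    pseudoScore p b 0 x = p * (1 - x) / (1 + Real.exp (b * (2 * p * x ^ (p - 1)))) *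
      (x ^ (p - 1) * (Real.exp (b * (2 * p * x ^ (p - 1))) -
        Real.exp (etaReal p x * (2 * p * x ^ (p - 1))))) := by
  have a1 : 0 < 1 + x := by linarith [hx.1]
  have a2 : 0 < 1 - x := by linarith [hx.2]
  have h1 : Real.exp (etaReal p x * (2 * p * x ^ (p - 1))) = (1 + x) / (1 - x) := by
    rw [show etaReal p x * (2 * p * x ^ (p - 1)) = 2 * (p * x ^ (p - 1) * etaReal p x) by ring,
      mul_etaReal hp h0, artanh_eq hx, ← mul_assoc]
    norm_num
    rw [Real.exp_sub, Real.exp_log a1, Real.exp_log a2]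
  rw [h1, pseudoScore, neg_zero, powSlope_zero, Real.exp_neg]
  have := Real.exp_pos (b * (2 * p * x ^ (p - 1)))
  field_simp
  ring

lemma mul_exp_sub_pos {p : ℕ} (hp : 0 < p) {y a b : ℝ} (hy : y ≠ 0) (hab : a < b) :
    0 < y * (Real.exp (b * (2 * p * y)) - Real.exp (a * (2 * p * y))) := by
  have hp' : (0 : ℝ) < p := by exact_mod_cast hp
  rcases lt_or_gt_of_ne hy with h | h
  · refine mul_pos_of_neg_of_neg h (sub_neg.2 (Real.exp_lt_exp.2 ?_))
    exact mul_lt_mul_of_neg_right hab (mul_neg_of_pos_of_neg (by positivity) h)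
  · refine mul_pos h (sub_pos.2 (Real.exp_lt_exp.2 ?_))
    exact mul_lt_mul_of_pos_right hab (by positivity)

lemma eventually_of_pseudoScore {p : ℕ} {b x₀ : ℝ} {U : Set ℝ} (hU : IsOpen U)
    (h : pseudoScore p b 0 x₀ ∈ U) : ∃ δ > 0, ∀ᶠ n : ℕ in atTop, 0 < n ∧ ∀ x : Config n,
      |magnetization x - x₀| < δ → pseudoScore p b (2 / n) (magnetization x) ∈ U := by
  have hc : ContinuousAt (fun z : ℝ × ℝ => pseudoScore p b z.1 z.2) (0, x₀) :=
    (continuous_pseudoScore p b).continuousAt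
  have := hc.eventually (hU.mem_nhds h)
  obtain ⟨δ, hδ, hb⟩ := Metric.eventually_nhds_iff.1 this
  refine ⟨δ, hδ, ?_⟩
  have hl := (tendsto_const_div_atTop_nhds_zero_nat (2 : ℝ)).eventually (Metric.ball_mem_nhds 0 hδ)
  filter_upwards [hl, eventually_gt_atTop 0] with n hn hn0
  refine ⟨hn0, fun x hx => ?_⟩
  refine hb (y := ((2 / n : ℝ), magnetization x)) ?_
  rw [Prod.dist_eq]
  exact max_lt hn hx

lemma tracksEta_mple {p : ℕ} (hp : 3 ≤ p) : TracksEta p (mple p) := by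
  intro x₀ hx₀ h0 c
  have hprof : ∀ {n : ℕ} (x : Config n), IsConcaveProfile
      (fun b => ∏ i : Fin n, condProb p b x i)
      (logisticDeriv (fun i => hamiltonian p x - hamiltonian p (flip x i))) := fun x =>
    isConcaveProfile_logistic fun b => Finset.prod_congr rfl fun i _ => condProb_eq p b x i
  have hy : x₀ ^ (p - 1) ≠ 0 := pow_ne_zero _ h0
  have hfac : ∀ b, 0 < p * (1 - x₀) / (1 + Real.exp (b * (2 * p * x₀ ^ (p - 1)))) := fun b => by
    have : 0 < 1 - x₀ := by linarith [hx₀.2]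
    positivity
  constructor
  · intro hlt
    obtain ⟨b, hcb, hb⟩ := exists_between hlt
    have hneg : pseudoScore p b 0 x₀ ∈ Set.Iio 0 := by
      rw [Set.mem_Iio, pseudoScore_zero hp b hx₀ h0]
      refine mul_neg_of_pos_of_neg (hfac b) ?_
      have := mul_exp_sub_pos (p := p) (by omega) hy hb
      linarith
    obtain ⟨δ, hδ, h⟩ := eventually_of_pseudoScore isOpen_Iio hneg
    refine ⟨δ, hδ, ?_⟩
    filter_upwards [h] with n hn x hx
    refine (EReal.coe_lt_coe_iff.2 hcb).trans_le ((hprof x).le_argmax ?_)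
    rw [logisticDeriv_eq hn.1]
    exact mul_neg_of_pos_of_neg (by exact_mod_cast hn.1) (hn.2 x hx)
  · intro hlt
    obtain ⟨b, hb, hcb⟩ := exists_between hlt
    have hneg : pseudoScore p b 0 x₀ ∈ Set.Ioi 0 := by
      rw [Set.mem_Ioi, pseudoScore_zero hp b hx₀ h0]
      exact mul_pos (hfac b) (mul_exp_sub_pos (p := p) (by omega) hy hb)
    obtain ⟨δ, hδ, h⟩ := eventually_of_pseudoScore isOpen_Ioi hneg
    refine ⟨δ, hδ, ?_⟩
    filter_upwards [h] with n hn x hx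
    refine ((hprof x).argmax_le ?_).trans_lt (EReal.coe_lt_coe_iff.2 hcb)
    rw [logisticDeriv_eq hn.1]
    exact mul_pos (by exact_mod_cast hn.1) (hn.2 x hx)

/-! ### Bahadur slopes -/
lemma mul_sub_coe_lt_iff {c b : ℝ} (hc : 0 < c) (x y : EReal) :
    (c : EReal) * (x - b) < c * (y - b) ↔ x < y := by
  have hr : ∀ a : ℝ, (c : EReal) * ((a : EReal) - b) = ((c * (a - b) : ℝ) : EReal) := fun a => by
    push_cast; rfl
  induction x <;> induction y <;>
    simp [hr, EReal.coe_mul_bot_of_pos hc, EReal.coe_mul_top_of_pos hc, -EReal.coe_mul,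
      -EReal.coe_sub, hc]

lemma pValue_eq {p n : ℕ} (β₀ : ℝ) (est : Estimator) (hn : 0 < n) (X : Config n) :
    pValue p β₀ est n X = prob p β₀ n {x | est n X < est n x} := by
  rw [pValue, nullCdf, ← prob_compl]
  congr 1
  ext x
  have hs : 0 < Real.sqrt n := Real.sqrt_pos.2 (by exact_mod_cast hn)
  simp only [Set.mem_compl_iff, Set.mem_ofPred_eq, not_le, testStat]
  exact mul_sub_coe_lt_iff hs _ _

/-- One factor `n + 1` comes from the probability estimate and one from the partition function. -/
lemma eventually_sq_le_exp {ε : ℝ} (hε : 0 < ε) :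
    ∀ᶠ n : ℕ in atTop, ((n : ℝ) + 1) ^ 2 ≤ Real.exp (n * ε) := by
  have h := (isLittleO_pow_exp_pos_mul_atTop 2 hε).bound (c := 1 / 4) (by norm_num)
  filter_upwards [tendsto_natCast_atTop_atTop.eventually h, eventually_ge_atTop 1] with n hn hn1
  have hn1' : (1 : ℝ) ≤ n := by exact_mod_cast hn1
  rw [Real.norm_of_nonneg (by positivity), Real.norm_of_nonneg (Real.exp_pos _).le,
    mul_comm ε] at hn
  nlinarith

lemma eventually_exists_rateH_ge {p : ℕ} {β a ρ ε : ℝ} (ha : a ∈ Set.Icc (-1 : ℝ) 1) (hρ : 0 < ρ)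
    (hε : 0 < ε) : ∀ᶠ n : ℕ in atTop, 0 < n ∧ ∃ k ≤ n, |level n k - a| < ρ ∧
      rateH β p a - ε ≤ rateH β p (level n k) := by
  have hev : ∀ᶠ x in 𝓝 a, rateH β p a - ε < rateH β p x :=
    (continuous_rateH β p).continuousAt.eventually (lt_mem_nhds (by linarith))
  obtain ⟨δ, hδ, h⟩ := Metric.eventually_nhds_iff.1 hev
  filter_upwards [eventually_exists_level ha (lt_min hρ hδ)] with n hn
  obtain ⟨hn0, k, hk, hd⟩ := hn
  exact ⟨hn0, k, hk, hd.trans_le (min_le_left _ _),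
    (h (y := level n k) (hd.trans_le (min_le_right _ _))).le⟩

lemma partitionFn_le {p n : ℕ} {β M : ℝ} (hn : 0 < n)
    (hM : ∀ x ∈ Set.Icc (-1 : ℝ) 1, rateH β p x ≤ M) :
    partitionFn p β n ≤ (n + 1) * Real.exp (n * M) := by
  have := prob_mul_partitionFn_le (p := p) (β := β) (r := M) hn (A := Set.univ)
    (fun x _ => hM _ (magnetization_mem hn x))
  rwa [prob_univ, one_mul] at this

lemma eventually_le_partitionFn {p : ℕ} {β a ε : ℝ} (ha : a ∈ Set.Icc (-1 : ℝ) 1) (hε : 0 < ε) :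
    ∀ᶠ n : ℕ in atTop, 0 < n ∧
      Real.exp (n * (rateH β p a - ε)) ≤ (n + 1) * partitionFn p β n := by
  filter_upwards [eventually_exists_rateH_ge (p := p) (β := β) ha one_pos hε] with n hn
  obtain ⟨hn0, k, hk, -, hr⟩ := hn
  have := exp_le_prob_mul_partitionFn hn0 hk (A := Set.univ) hr (fun _ _ => Set.mem_univ _)
  rw [prob_univ, one_mul] at this
  exact ⟨hn0, this⟩

/-- The magnetization concentrates at the maximizers of the rate function. -/
lemma tendsto_prob_of_rateH_lt {p : ℕ} {β a : ℝ} (ha : a ∈ Set.Icc (-1 : ℝ) 1) {U : Set ℝ}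
    (hU : IsOpen U) (h : ∀ x ∈ Set.Icc (-1 : ℝ) 1, x ∉ U → rateH β p x < rateH β p a) :
    Tendsto (fun n : ℕ => prob p β n {x | magnetization x ∈ U}) atTop (𝓝 1) := by
  -- Compactness turns the strict inequality into a uniform gap. Of `4 * γ`, one share pays for the
  -- partition function and one for `(n + 1) ^ 2`; what is left gives exponential decay.
  obtain ⟨γ, hγ, hK⟩ : ∃ γ > 0, ∀ x ∈ Set.Icc (-1 : ℝ) 1, x ∉ U →
      rateH β p x ≤ rateH β p a - 4 * γ := by
    rcases (Set.Icc (-1 : ℝ) 1 ∩ Uᶜ).eq_empty_or_nonempty with he | hne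
    · refine ⟨1, one_pos, fun x hx hxU => ?_⟩
      have : x ∈ Set.Icc (-1 : ℝ) 1 ∩ Uᶜ := ⟨hx, hxU⟩
      simp [he] at this
    · obtain ⟨y, hy, hmax⟩ := (isCompact_Icc.inter_right hU.isClosed_compl).exists_isMaxOn hne
        (continuous_rateH β p).continuousOn
      have := h y hy.1 hy.2
      refine ⟨(rateH β p a - rateH β p y) / 4, by linarith, fun x hx hxU => ?_⟩
      have : rateH β p x ≤ rateH β p y := hmax ⟨hx, hxU⟩
      linarith
  have hlim : Tendsto (fun n : ℕ => 1 - Real.exp (-(n * γ))) atTop (𝓝 1) := by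
    have : Tendsto (fun n : ℕ => (n : ℝ) * γ) atTop atTop :=
      tendsto_natCast_atTop_atTop.atTop_mul_const hγ
    simpa using (Real.tendsto_exp_neg_atTop_nhds_zero.comp this).const_sub 1
  refine tendsto_of_tendsto_of_tendsto_of_le_of_le' hlim tendsto_const_nhds ?_ ?_
  · filter_upwards [eventually_le_partitionFn (p := p) (β := β) ha hγ, eventually_sq_le_exp hγ]
      with n hn hsq
    obtain ⟨hn0, hZ⟩ := hn
    have hZ0 := partitionFn_pos p β n
    have hc := prob_compl p β {x : Config n | magnetization x ∈ U}
    have hup := prob_mul_partitionFn_le (p := p) (β := β) (r := rateH β p a - 4 * γ) hn0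
      (A := {x : Config n | magnetization x ∈ U}ᶜ)
      (fun x hx => hK _ (magnetization_mem hn0 x) hx)
    have hq : prob p β n {x : Config n | magnetization x ∈ U}ᶜ ≤ Real.exp (-(n * γ)) := by
      rw [← mul_le_mul_iff_left₀ hZ0]
      refine hup.trans ?_
      have hn1 : (0 : ℝ) < n + 1 := by positivity
      rw [← mul_le_mul_iff_right₀ hn1]
      calc ((n : ℝ) + 1) * ((n + 1) * Real.exp (n * (rateH β p a - 4 * γ)))
          = (n + 1) ^ 2 * Real.exp (n * (rateH β p a - 4 * γ)) := by ring
        _ ≤ Real.exp (n * γ) * Real.exp (n * (rateH β p a - 4 * γ)) := by gcongr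
        _ ≤ Real.exp (-(n * γ)) * Real.exp (n * (rateH β p a - γ)) := by
          rw [← Real.exp_add, ← Real.exp_add]
          refine Real.exp_le_exp.2 ?_
          have : 0 ≤ (n : ℝ) * γ := by positivity
          linarith
        _ ≤ Real.exp (-(n * γ)) * ((n + 1) * partitionFn p β n) := by gcongr
        _ = _ := by ring
    linarith
  · filter_upwards with n
    have := prob_mono p β (Set.subset_univ {x : Config n | magnetization x ∈ U})
    rwa [prob_univ] at this

/-- A sample whose magnetization `m` satisfies `|m ^ p - t ^ p| < δ`. -/
def Near (p : ℕ) (t δ : ℝ) {n : ℕ} (X : Config n) : Prop := |magnetization X ^ p - t ^ p| < δ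

lemma Near.mono {p : ℕ} {t δ δ' : ℝ} {n : ℕ} {X : Config n} (h : Near p t δ X) (hd : δ ≤ δ') :
    Near p t δ' X := lt_of_lt_of_le h hd

/-- `r` plays the supremum of the null rate over the samples with a larger estimate: `hup` bounds
the rate on that set, and `hlo` puts a whole neighbourhood of a nearly optimal point inside it.
Dividing by the partition function subtracts the maximum `rateH β₀ p a`. -/
theorem isBahadurSlope_of_rate {p : ℕ} {β₀ β t r a : ℝ} {est : Estimator}
    (hconc : ∀ δ : ℝ, 0 < δ → Tendsto (fun n : ℕ => prob p β n {X | Near p t δ X}) atTop (𝓝 1))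
    (ha : a ∈ Set.Icc (-1 : ℝ) 1)
    (hmax : ∀ x ∈ Set.Icc (-1 : ℝ) 1, rateH β₀ p x ≤ rateH β₀ p a)
    (hup : ∀ ε : ℝ, 0 < ε → ∃ δ > 0, ∀ᶠ n : ℕ in atTop, ∀ X x : Config n, Near p t δ X →
      est n X < est n x → rateH β₀ p (magnetization x) ≤ r + ε)
    (hlo : ∀ ε : ℝ, 0 < ε → ∃ x₀ ∈ Set.Icc (-1 : ℝ) 1, r - ε ≤ rateH β₀ p x₀ ∧
      ∃ δ > 0, ∃ ρ > 0, ∀ᶠ n : ℕ in atTop, ∀ X x : Config n, Near p t δ X →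
        |magnetization x - x₀| < ρ → est n X < est n x) :
    IsBahadurSlope p β₀ β est (2 * (rateH β₀ p a - r)) := by
  intro ε hε
  set M := rateH β₀ p a with hM
  -- Each bound loses three times: upwards through `hup`, the polynomial factors and the partition
  -- function; downwards through `hlo`, the lattice approximation and the polynomial factors.
  set e := ε / 3 with he
  have he0 : 0 < e := by positivity
  obtain ⟨δ₁, hδ₁, h1⟩ := hup e he0
  obtain ⟨x₀, hx₀, hr, δ₂, hδ₂, ρ, hρ, h2⟩ := hlo e he0
  refine tendsto_of_tendsto_of_tendsto_of_le_of_le' (hconc (min δ₁ δ₂) (lt_min hδ₁ hδ₂))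
    tendsto_const_nhds ?_ ?_
  swap
  · filter_upwards with n
    exact (prob_mono p β (Set.subset_univ _)).trans_eq (prob_univ p β n)
  filter_upwards [h1, h2, eventually_le_partitionFn (p := p) (β := β₀) ha he0,
    eventually_exists_rateH_ge (p := p) (β := β₀) hx₀ hρ he0, eventually_sq_le_exp he0]
    with n h1 h2 hZ hk hsq
  refine prob_mono p β fun X hX => ?_
  obtain ⟨hn0, k, hkn, hkd, hkr⟩ := hk
  replace hZ := hZ.2
  have hZ0 := partitionFn_pos p β₀ n
  have hn : (0 : ℝ) < n := by positivity
  have hn1 : (0 : ℝ) < n + 1 := by positivity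
  have hX1 : Near p t δ₁ X := Near.mono hX (min_le_left _ _)
  have hX2 : Near p t δ₂ X := Near.mono hX (min_le_right _ _)
  set L := pValue p β₀ est n X with hL
  have hLe : L = prob p β₀ n {x | est n X < est n x} := pValue_eq β₀ est hn0 X
  have hupper := prob_mul_partitionFn_le (p := p) (β := β₀) (r := r + e) hn0
    (A := {x | est n X < est n x}) (fun x hx => h1 X x hX1 hx)
  have hlower := exp_le_prob_mul_partitionFn (p := p) (β := β₀) (r := r - 2 * e) hn0 hkn
    (A := {x | est n X < est n x}) (by linarith) (fun x hx => h2 X x hX2 (by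
      rw [magnetization_eq_level, hx]; exact hkd))
  rw [← hLe] at hupper hlower
  have hZle := partitionFn_le (p := p) (β := β₀) hn0 hmax
  have hLpos : 0 < L := by
    by_contra! hc
    have : (n + 1) * (L * partitionFn p β₀ n) ≤ 0 :=
      mul_nonpos_of_nonneg_of_nonpos hn1.le (mul_nonpos_of_nonpos_of_nonneg hc hZ0.le)
    linarith [Real.exp_pos (n * (r - 2 * e))]
  have hLup : L ≤ Real.exp (n * (r - M + 3 * e)) := by
    have : L * Real.exp (n * (M - e)) ≤ Real.exp (n * (r - M + 3 * e)) * Real.exp (n * (M - e)) := by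
      calc L * Real.exp (n * (M - e)) ≤ L * ((n + 1) * partitionFn p β₀ n) := by gcongr
        _ = (n + 1) * (L * partitionFn p β₀ n) := by ring
        _ ≤ (n + 1) * ((n + 1) * Real.exp (n * (r + e))) := by gcongr
        _ = (n + 1) ^ 2 * Real.exp (n * (r + e)) := by ring
        _ ≤ Real.exp (n * e) * Real.exp (n * (r + e)) := by gcongr
        _ = _ := by rw [← Real.exp_add, ← Real.exp_add]; congr 1; ring
    exact le_of_mul_le_mul_right this (Real.exp_pos _)
  have hLlo : Real.exp (n * (r - M - 3 * e)) ≤ L := by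
    have : Real.exp (n * (r - M - 3 * e)) * Real.exp (n * (M + e)) ≤ L * Real.exp (n * (M + e)) := by
      calc Real.exp (n * (r - M - 3 * e)) * Real.exp (n * (M + e)) = Real.exp (n * (r - 2 * e)) := by
            rw [← Real.exp_add]; congr 1; ring
        _ ≤ (n + 1) * (L * partitionFn p β₀ n) := hlower
        _ ≤ (n + 1) * (L * ((n + 1) * Real.exp (n * M))) := by gcongr
        _ = L * ((n + 1) ^ 2 * Real.exp (n * M)) := by ring
        _ ≤ L * (Real.exp (n * e) * Real.exp (n * M)) := by gcongr
        _ = _ := by rw [← Real.exp_add]; congr 2; ring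
    exact le_of_mul_le_mul_right this (Real.exp_pos _)
  refine ⟨hLpos, ?_⟩
  have l1 := Real.log_le_log hLpos hLup
  have l2 := Real.log_le_log (Real.exp_pos _) hLlo
  rw [Real.log_exp] at l1 l2
  have hne : (n : ℝ)⁻¹ * n = 1 := inv_mul_cancel₀ hn.ne'
  have k1 := mul_le_mul_of_nonneg_left l1 (inv_pos.2 hn).le
  have k2 := mul_le_mul_of_nonneg_left l2 (inv_pos.2 hn).le
  rw [← mul_assoc, hne, one_mul] at k1 k2
  rw [abs_le]
  constructor <;> linarith

/-! ### The slopes of the two kinds of estimators -/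

section
variable {p : ℕ} {β₀ β s₀ t₀ s t : ℝ}

lemma IsLevelPair.lt_of_lt (h₀ : IsLevelPair p β₀ s₀ t₀) (h : IsLevelPair p β s t) (hβ : β₀ < β) :
    s < s₀ ∧ t₀ < t := by
  have a := h₀.s_pos
  have b := h₀.s_lt
  have c := h₀.t_lt
  constructor
  · by_contra! hc
    rcases hc.lt_or_eq with hc | rfl
    · linarith [h.gt_left s₀ a hc, h₀.eta_s]
    · linarith [h.eta_s, h₀.eta_s]
  · by_contra! hc
    rcases hc.lt_or_eq with hc | rfl
    · linarith [h.gt_right t₀ hc c, h₀.eta_t]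
    · linarith [h.eta_t, h₀.eta_t]

lemma IsLevelPair.t_mem (h : IsLevelPair p β s t) : t ∈ Set.Icc (-1 : ℝ) 1 :=
  ⟨by linarith [h.s_pos, h.s_lt], h.t_lt.le⟩

lemma IsLevelPair.tendsto_prob_near (h : IsLevelPair p β s t) (hp : 3 ≤ p) (hβ : 0 ≤ β)
    (hpos : 0 < rateH β p t) (δ : ℝ) (hδ : 0 < δ) :
    Tendsto (fun n : ℕ => prob p β n {X | Near p t δ X}) atTop (𝓝 1) := by
  have hU : IsOpen {x : ℝ | |x ^ p - t ^ p| < δ} := isOpen_lt (by fun_prop) continuous_const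
  have hlt : ∀ x ∈ Set.Icc (-1 : ℝ) 1, x ∉ {x : ℝ | |x ^ p - t ^ p| < δ} →
      rateH β p x < rateH β p t := fun x hx hxU =>
    h.rateH_lt_of_pow_ne hp hβ hpos hx fun he => hxU (by simpa [he] using hδ)
  have e : ∀ n : ℕ, {X : Config n | magnetization X ∈ {x : ℝ | |x ^ p - t ^ p| < δ}} =
      {X : Config n | Near p t δ X} := fun n => by
    ext X
    simp only [Set.mem_ofPred_eq, Near]
  have hT := tendsto_prob_of_rateH_lt h.t_mem hU hlt
  simp only [e] at hT
  exact hT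

lemma exists_right_rateH_ge (β₀ : ℝ) (p : ℕ) {ε : ℝ} (hε : 0 < ε) (ht : t < 1) :
    ∃ x₀ ∈ Set.Ioo t 1, rateH β₀ p t - ε ≤ rateH β₀ p x₀ := by
  have hev : ∀ᶠ x in 𝓝[>] t, rateH β₀ p t - ε < rateH β₀ p x :=
    ((continuous_rateH β₀ p).continuousAt.eventually (lt_mem_nhds (by linarith))).filter_mono
      nhdsWithin_le_nhds
  obtain ⟨x, hx, hx'⟩ := (hev.and (Ioo_mem_nhdsGT ht)).exists
  exact ⟨x, hx', hx.le⟩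

/-- The slope of the maximum likelihood estimator. -/
theorem isBahadurSlope_mle (hp : 3 ≤ p) (hβ₀ : 0 ≤ β₀) (hβ : β₀ < β)
    (h₀ : IsLevelPair p β₀ s₀ t₀) (hpos₀ : 0 < rateH β₀ p t₀)
    (h : IsLevelPair p β s t) (hpos : 0 < rateH β p t) :
    IsBahadurSlope p β₀ β (mle p) (2 * (rateH β₀ p t₀ - rateH β₀ p t)) := by
  have htt := (h₀.lt_of_lt h hβ).2
  have ht0 : 0 < t := h.s_pos.trans h.s_lt
  have ht₀0 : 0 < t₀ := h₀.s_pos.trans h₀.s_lt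
  refine isBahadurSlope_of_rate (h.tendsto_prob_near hp (hβ₀.trans hβ.le) hpos) h₀.t_mem
    (fun x hx => h₀.rateH_le_rateH hp hβ₀ hpos₀ hx) (fun ε hε => ?_) (fun ε hε => ?_)
  -- Larger estimates force `|x| > u` with `u` just below `t`. As `u > t₀`, the null rate decreases
  -- from `u` on, so its value at `u` bounds it.
  · have hev : ∀ᶠ x in 𝓝[<] t, rateH β₀ p x < rateH β₀ p t + ε :=
      ((continuous_rateH β₀ p).continuousAt.eventually (gt_mem_nhds (by linarith))).filter_mono
        nhdsWithin_le_nhds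
    obtain ⟨u, hu, hu'⟩ := (hev.and (Ioo_mem_nhdsLT htt)).exists
    have hu0 : 0 < u := ht₀0.trans hu'.1
    refine ⟨t ^ p - u ^ p, sub_pos.2 (pow_lt_pow_left₀ hu'.2 hu0.le (by omega)), ?_⟩
    filter_upwards [eventually_gt_atTop 0] with n hn X x hX hlt
    rw [mle_lt_mle_iff hn] at hlt
    have h1 := (abs_lt.1 hX).1
    have h2 : u ^ p < magnetization x ^ p := by linarith
    have h3 : 0 < magnetization x ^ p := (pow_pos hu0 p).trans h2
    have h4 := abs_mem_Icc (magnetization_mem hn x)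
    rw [rateH_eq_abs h3]
    rw [pow_eq_abs_pow_of_pos h3] at h2
    have h5 := lt_of_pow_lt_pow_left₀ p h4.1 h2
    have := (h₀.anti_right hp).antitoneOn ⟨hu'.1.le, (hu'.2.trans h.t_lt).le⟩
      ⟨(hu'.1.trans h5).le, h4.2⟩ h5.le
    linarith
  · obtain ⟨x₀, hx₀, hr⟩ := exists_right_rateH_ge β₀ p hε h.t_lt
    have hpw : t ^ p < x₀ ^ p := pow_lt_pow_left₀ hx₀.1 ht0.le (by omega)
    refine ⟨x₀, ⟨by linarith [hx₀.1], hx₀.2.le⟩, hr, (x₀ ^ p - t ^ p) / 2, by linarith, ?_⟩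
    have hev : ∀ᶠ x in 𝓝 x₀, (x₀ ^ p + t ^ p) / 2 < x ^ p :=
      (continuous_pow p).continuousAt.eventually (lt_mem_nhds (by linarith))
    obtain ⟨ρ, hρ, hb⟩ := Metric.eventually_nhds_iff.1 hev
    refine ⟨ρ, hρ, ?_⟩
    filter_upwards [eventually_gt_atTop 0] with n hn X x hX hx
    rw [mle_lt_mle_iff hn]
    have h1 := (abs_lt.1 hX).2
    have h2 := hb (y := magnetization x) hx
    linarith

/-- Near the points where the magnetization concentrates, an estimator that tracks `η_p` is close
to `β`. -/
lemma TracksEta.of_near {est : Estimator} (hest : TracksEta p est) (hp : 3 ≤ p)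
    (h : IsLevelPair p β s t) (c : ℝ) :
    (c < β → ∃ δ > 0, ∀ᶠ n : ℕ in atTop, ∀ X : Config n, Near p t δ X → (c : EReal) < est n X) ∧
    (β < c → ∃ δ > 0, ∀ᶠ n : ℕ in atTop, ∀ X : Config n, Near p t δ X → est n X < (c : EReal)) := by
  have ht0 : 0 < t := h.s_pos.trans h.s_lt
  -- If `m ^ p` is close to `t ^ p`, then `m` is close to `t`, or to `-t` with `p` even.
  have hkey : ∀ P : (n : ℕ) → Config n → Prop,
      (∃ δ > 0, ∀ᶠ n : ℕ in atTop, ∀ X : Config n, |magnetization X - t| < δ → P n X) →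
      (Even p → ∃ δ > 0, ∀ᶠ n : ℕ in atTop, ∀ X : Config n,
        |magnetization X - -t| < δ → P n X) →
      ∃ δ > 0, ∀ᶠ n : ℕ in atTop, ∀ X : Config n, Near p t δ X → P n X := by
    intro P h1 h2
    obtain ⟨δ₁, hδ₁, h1⟩ := h1
    obtain ⟨δ₂, hδ₂, h2⟩ : ∃ δ > 0, ∀ᶠ n : ℕ in atTop, ∀ X : Config n,
        Even p → |magnetization X - -t| < δ → P n X := by
      by_cases he : Even p
      · obtain ⟨δ, hδ, h⟩ := h2 he
        exact ⟨δ, hδ, h.mono fun n hn X _ => hn X⟩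
      · exact ⟨1, one_pos, Eventually.of_forall fun n X he' => absurd he' he⟩
    set ρ := min (min δ₁ δ₂) t with hρ
    have hρ0 : 0 < ρ := lt_min (lt_min hδ₁ hδ₂) ht0
    have hρt : ρ ≤ t := min_le_right _ _
    have hρ1 : ρ ≤ δ₁ := (min_le_left _ _).trans (min_le_left _ _)
    have hρ2 : ρ ≤ δ₂ := (min_le_left _ _).trans (min_le_right _ _)
    have q1 : (t - ρ) ^ p < t ^ p := pow_lt_pow_left₀ (by linarith) (by linarith) (by omega)
    have q2 : t ^ p < (t + ρ) ^ p := pow_lt_pow_left₀ (by linarith) ht0.le (by omega)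
    refine ⟨min (t ^ p - (t - ρ) ^ p) ((t + ρ) ^ p - t ^ p), lt_min (by linarith) (by linarith), ?_⟩
    filter_upwards [h1, h2] with n h1 h2 X hX
    set m := magnetization X with hm
    have n1 := abs_lt.1 (Near.mono hX (min_le_left _ _))
    have n2 := abs_lt.1 (Near.mono hX (min_le_right _ _))
    rw [← hm] at n1 n2
    have n3 : (t - ρ) ^ p < m ^ p := by linarith [n1.1]
    have n4 : m ^ p < (t + ρ) ^ p := by linarith [n2.2]
    have hm0 : 0 < m ^ p := (pow_nonneg (by linarith) p).trans_lt n3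
    rw [pow_eq_abs_pow_of_pos hm0] at n3 n4
    have n5 := lt_of_pow_lt_pow_left₀ p (abs_nonneg m) n3
    have n6 := lt_of_pow_lt_pow_left₀ p (by linarith) n4
    rcases le_total 0 m with hs | hs
    · rw [abs_of_nonneg hs] at n5 n6
      exact h1 X (abs_lt.2 ⟨by linarith, by linarith⟩)
    · rw [abs_of_nonpos hs] at n5 n6
      have hev : Even p := by
        by_contra hc
        have := (Nat.not_even_iff_odd.1 hc).pow_nonpos hs
        linarith
      exact h2 X hev (abs_lt.2 ⟨by linarith, by linarith⟩)
  have htm : t ∈ Set.Ioo (-1 : ℝ) 1 := ⟨by linarith, h.t_lt⟩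
  have htn : -t ∈ Set.Ioo (-1 : ℝ) 1 := ⟨by linarith [h.t_lt], by linarith⟩
  have heta : Even p → etaReal p (-t) = β := fun he => by
    rw [etaReal_eq_abs htn (by rw [he.neg_pow]; positivity), abs_neg, abs_of_pos ht0, h.eta_t]
  constructor
  · intro hc
    refine hkey (fun n X => (c : EReal) < est n X) ?_ fun he => ?_
    · exact (hest t htm ht0.ne' c).1 (by rwa [h.eta_t])
    · exact (hest (-t) htn (by linarith) c).1 (by rwa [heta he])
  · intro hc
    refine hkey (fun n X => est n X < (c : EReal)) ?_ fun he => ?_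
    · exact (hest t htm ht0.ne' c).2 (by rwa [h.eta_t])
    · exact (hest (-t) htn (by linarith) c).2 (by rwa [heta he])

/-- Points of large rate, at which `η_p` takes values below `β`. -/
lemma etaReal_lt_of_rateH_gt (hp : 3 ≤ p) (hβ₀ : 0 ≤ β₀) (hβ : β₀ < β)
    (h₀ : IsLevelPair p β₀ s₀ t₀) (h : IsLevelPair p β s t) {x : ℝ}
    (hx : x ∈ Set.Icc (-1 : ℝ) 1) (hr : max 0 (rateH β₀ p t) < rateH β₀ p x) :
    x ∈ Set.Ioo (-1 : ℝ) 1 ∧ x ≠ 0 ∧ etaReal p x < β := by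
  obtain ⟨hss, htt⟩ := h₀.lt_of_lt h hβ
  have hx0 : 0 < rateH β₀ p x := (le_max_left _ _).trans_lt hr
  have hxp := pow_pos_of_rateH_pos hβ₀ hx hx0
  have hrt := (le_max_right _ _).trans_lt hr
  have ha := abs_mem_Icc hx
  rw [rateH_eq_abs hxp] at hrt hx0
  have h1 : |x| < t := by
    by_contra! hc
    have := (h₀.anti_right hp).antitoneOn ⟨htt.le, h.t_lt.le⟩ ⟨htt.le.trans hc, ha.2⟩ hc
    linarith
  have h2 : s < |x| := by
    by_contra! hc
    have := (h₀.anti_left hp).antitoneOn ⟨le_rfl, h₀.s_pos.le⟩ ⟨ha.1, hc.trans hss.le⟩ ha.1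
    rw [rateH_zero β₀ hp] at this
    linarith
  have hx1 : x ∈ Set.Ioo (-1 : ℝ) 1 := abs_lt.1 (h1.trans h.t_lt)
  refine ⟨hx1, ?_, ?_⟩
  · rintro rfl
    simp [show p ≠ 0 by omega] at hxp
  · rw [etaReal_eq_abs hx1 hxp]
    exact h.lt_of_mem _ h2 h1

/-- The slope of an estimator that tracks `η_p`. -/
theorem isBahadurSlope_of_tracksEta {est : Estimator} (hest : TracksEta p est) (hp : 3 ≤ p)
    (hβ₀ : 0 ≤ β₀) (hβ : β₀ < β)
    (h₀ : IsLevelPair p β₀ s₀ t₀) (hpos₀ : 0 < rateH β₀ p t₀)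
    (h : IsLevelPair p β s t) (hpos : 0 < rateH β p t) :
    IsBahadurSlope p β₀ β est (2 * (rateH β₀ p t₀ - max 0 (rateH β₀ p t))) := by
  refine isBahadurSlope_of_rate (h.tendsto_prob_near hp (hβ₀.trans hβ.le) hpos) h₀.t_mem
    (fun x hx => h₀.rateH_le_rateH hp hβ₀ hpos₀ hx) (fun ε hε => ?_) (fun ε hε => ?_)
  · set r := max 0 (rateH β₀ p t) with hr
    -- On this compact set `η_p < β`, so each point has a neighbourhood where the estimate stays
    -- below the observed one. Compactness makes `δ` and the threshold on `n` uniform.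
    set K : Set ℝ := Set.Icc (-1 : ℝ) 1 ∩ {x | r + ε ≤ rateH β₀ p x} with hK
    have hKc : IsCompact K :=
      isCompact_Icc.inter_right (isClosed_le continuous_const (continuous_rateH β₀ p))
    have hcover : ∃ δ > 0, ∀ᶠ n : ℕ in atTop, ∀ X x : Config n, Near p t δ X →
        magnetization x ∈ K → est n x ≤ est n X := by
      refine hKc.induction_on (p := fun A => ∃ δ > 0, ∀ᶠ n : ℕ in atTop, ∀ X x : Config n,
        Near p t δ X → magnetization x ∈ A → est n x ≤ est n X) ?_ ?_ ?_ ?_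
      · exact ⟨1, one_pos, Eventually.of_forall fun n X x _ hx => absurd hx (Set.notMem_empty _)⟩
      · rintro A B hAB ⟨δ, hδ, hB⟩
        exact ⟨δ, hδ, hB.mono fun n hn X x hX hx => hn X x hX (hAB hx)⟩
      · rintro A B ⟨δ₁, hδ₁, hA⟩ ⟨δ₂, hδ₂, hB⟩
        refine ⟨min δ₁ δ₂, lt_min hδ₁ hδ₂, ?_⟩
        filter_upwards [hA, hB] with n hA hB X x hX hx
        rcases hx with hx | hx
        · exact hA X x (hX.mono (min_le_left _ _)) hx
        · exact hB X x (hX.mono (min_le_right _ _)) hx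
      · rintro y ⟨hy, hyr⟩
        have hyr' : r < rateH β₀ p y := by
          have : r + ε ≤ rateH β₀ p y := hyr
          linarith
        obtain ⟨hy1, hy0, hylt⟩ := etaReal_lt_of_rateH_gt hp hβ₀ hβ h₀ h hy hyr'
        obtain ⟨c, hc1, hc2⟩ := exists_between hylt
        obtain ⟨ρ, hρ, hev⟩ := (hest y hy1 hy0 c).2 hc1
        obtain ⟨δ, hδ, hev'⟩ := (hest.of_near hp h c).1 hc2
        refine ⟨Metric.ball y ρ, mem_nhdsWithin_of_mem_nhds (Metric.ball_mem_nhds y hρ), δ, hδ, ?_⟩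
        filter_upwards [hev, hev'] with n h1 h2 X x hX hx
        exact ((h1 x hx).trans (h2 X hX)).le
    obtain ⟨δ, hδ, hev⟩ := hcover
    refine ⟨δ, hδ, ?_⟩
    filter_upwards [hev, eventually_gt_atTop 0] with n hn hn0 X x hX hlt
    by_contra! hc
    exact (hn X x hX ⟨magnetization_mem hn0 x, hc.le⟩).not_gt hlt
  -- Both pieces of the set where `η_p > β` are used: points near `0` in `(0, s)` if the maximum is
  -- `0`, points just right of `t` otherwise.
  · obtain ⟨x₀, hx₀, hr, hxeta⟩ : ∃ x₀ ∈ Set.Ioo (0 : ℝ) 1,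
        max 0 (rateH β₀ p t) - ε ≤ rateH β₀ p x₀ ∧ β < etaReal p x₀ := by
      rcases max_choice 0 (rateH β₀ p t) with hm | hm <;> rw [hm]
      · have hev : ∀ᶠ x in 𝓝[>] (0 : ℝ), rateH β₀ p 0 - ε < rateH β₀ p x :=
          ((continuous_rateH β₀ p).continuousAt.eventually (lt_mem_nhds (by linarith))).filter_mono
            nhdsWithin_le_nhds
        obtain ⟨x, hx, hx'⟩ := (hev.and (Ioo_mem_nhdsGT h.s_pos)).exists
        rw [rateH_zero β₀ hp] at hx
        exact ⟨x, ⟨hx'.1, hx'.2.trans (h.s_lt.trans h.t_lt)⟩, hx.le, h.gt_left x hx'.1 hx'.2⟩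
      · obtain ⟨x₀, hx₀, hr⟩ := exists_right_rateH_ge β₀ p hε h.t_lt
        exact ⟨x₀, ⟨(h.s_pos.trans h.s_lt).trans hx₀.1, hx₀.2⟩, hr, h.gt_right x₀ hx₀.1 hx₀.2⟩
    obtain ⟨c, hc1, hc2⟩ := exists_between hxeta
    have hx1 : x₀ ∈ Set.Ioo (-1 : ℝ) 1 := ⟨by linarith [hx₀.1], hx₀.2⟩
    obtain ⟨ρ, hρ, hev⟩ := (hest x₀ hx1 hx₀.1.ne' c).1 hc2
    obtain ⟨δ, hδ, hev'⟩ := (hest.of_near hp h c).2 hc1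
    refine ⟨x₀, ⟨hx1.1.le, hx1.2.le⟩, hr, δ, hδ, ρ, hρ, ?_⟩
    filter_upwards [hev, hev'] with n h1 h2 X x hX hx
    exact (h2 X hX).trans (h1 x hx)

/-- A positive maximum of the rate function stays positive when the parameter grows. -/
lemma exists_isLevelPair_of_lt (hp : 3 ≤ p) (hβ₀ : 0 ≤ β₀)
    (hex : ∃ x ∈ Set.Icc (-1 : ℝ) 1, 0 < rateH β₀ p x) (hβ : β₀ < β) :
    ∃ s t, IsLevelPair p β s t ∧ 0 < rateH β p t := by
  obtain ⟨x, hx, hxr⟩ := hex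
  have hxp := pow_pos_of_rateH_pos hβ₀ hx hxr
  refine exists_isLevelPair_of_rateH_pos hp (hβ₀.trans hβ.le) hx (hxr.trans_le ?_)
  have := mul_le_mul_of_nonneg_right hβ.le hxp.le
  rw [rateH, rateH]
  linarith

end

lemma optimalSampleSize_ne {c₁ c₂ δ : ℝ} (h₁ : 0 < c₁) (h₂ : 0 < c₂) (hne : c₁ ≠ c₂) (hδ : 0 < δ)
    (hδ' : δ < 1) : optimalSampleSize c₁ δ ≠ optimalSampleSize c₂ δ := by
  have hl := Real.log_neg hδ hδ'
  rw [optimalSampleSize, optimalSampleSize, Ne, div_eq_div_iff h₁.ne' h₂.ne']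
  intro h
  exact hne (mul_left_cancel₀ (by linarith : -(2 * Real.log δ) ≠ 0) h).symm

end TensorCurieWeiss

end

/-! ### Comparison of the slopes in the two regimes -/

open TensorCurieWeiss in
theorem theorem3 (p : ℕ) (hp : 3 ≤ p) :
    (∀ β₀ β : ℝ, Real.log 2 ≤ β₀ → β₀ < β →
      ∃ cMPL cML : ℝ, 0 < cMPL ∧ 0 < cML ∧
        TensorCurieWeiss.IsBahadurSlope p β₀ β (TensorCurieWeiss.mple p) cMPL ∧
        TensorCurieWeiss.IsBahadurSlope p β₀ β (TensorCurieWeiss.mpleClosedForm p) cMPL ∧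
        TensorCurieWeiss.IsBahadurSlope p β₀ β (TensorCurieWeiss.mle p) cML ∧
        cMPL = cML ∧
        (∀ δ : ℝ, 0 < δ → δ < 1 →
          TensorCurieWeiss.optimalSampleSize cMPL δ = TensorCurieWeiss.optimalSampleSize cML δ) ∧
        TensorCurieWeiss.bahadurARE cML cMPL = 1) ∧
    (∀ β₀ : ℝ, TensorCurieWeiss.betaStar p < β₀ → β₀ < Real.log 2 →
      ∃ B : ℝ, ∀ β : ℝ, β₀ < β → B < β →
        ∃ cMPL cML : ℝ, 0 < cMPL ∧ 0 < cML ∧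
          TensorCurieWeiss.IsBahadurSlope p β₀ β (TensorCurieWeiss.mple p) cMPL ∧
          TensorCurieWeiss.IsBahadurSlope p β₀ β (TensorCurieWeiss.mpleClosedForm p) cMPL ∧
          TensorCurieWeiss.IsBahadurSlope p β₀ β (TensorCurieWeiss.mle p) cML ∧
          cMPL ≠ cML ∧
          (∀ δ : ℝ, 0 < δ → δ < 1 →
            TensorCurieWeiss.optimalSampleSize cMPL δ ≠
              TensorCurieWeiss.optimalSampleSize cML δ) ∧
          1 < TensorCurieWeiss.bahadurARE cML cMPL) := by
  constructor
  · intro β₀ β hlog hβ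
    have hβ₀ : 0 ≤ β₀ := (Real.log_nonneg (by norm_num)).trans hlog
    obtain ⟨x, hx, hxr⟩ := exists_rateH_pos_of_log_two_le hp hlog
    obtain ⟨s₀, t₀, h₀, hpos₀⟩ := exists_isLevelPair_of_rateH_pos hp hβ₀ hx hxr
    obtain ⟨s, t, h, hpos⟩ := exists_isLevelPair_of_lt hp hβ₀ ⟨x, hx, hxr⟩ hβ
    have htt := (h₀.lt_of_lt h hβ).2
    have hlt := h₀.anti_right hp ⟨le_rfl, h₀.t_lt.le⟩ ⟨htt.le, h.t_lt.le⟩ htt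
    -- The null rate at `t` exceeds its value `β₀ - log 2 ≥ 0` at `1`, so the maximum with `0` has
    -- no effect.
    have h1 := h₀.anti_right hp ⟨htt.le, h.t_lt.le⟩ ⟨h₀.t_lt.le, le_rfl⟩ h.t_lt
    rw [rateH_one] at h1
    have hmax : max 0 (rateH β₀ p t) = rateH β₀ p t := max_eq_right (by linarith)
    have hc : 0 < 2 * (rateH β₀ p t₀ - rateH β₀ p t) := by linarith
    have hT := fun est (hest : TracksEta p est) =>
      hmax ▸ isBahadurSlope_of_tracksEta hest hp hβ₀ hβ h₀ hpos₀ h hpos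
    exact ⟨_, _, hc, hc, hT _ (tracksEta_mple hp), hT _ (tracksEta_mpleClosedForm p),
      isBahadurSlope_mle hp hβ₀ hβ h₀ hpos₀ h hpos, rfl, fun _ _ _ => rfl, div_self hc.ne'⟩
  · intro β₀ hstar hlog
    have hβ₀ : 0 ≤ β₀ := (betaStar_nonneg hp).trans hstar.le
    obtain ⟨x, hx, hxr⟩ := exists_rateH_pos_of_betaStar_lt hp hstar
    obtain ⟨s₀, t₀, h₀, hpos₀⟩ := exists_isLevelPair_of_rateH_pos hp hβ₀ hx hxr
    obtain ⟨v, hv, hvr⟩ : ∃ v ∈ Set.Ioo t₀ 1, rateH β₀ p v < 0 := by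
      have hev : ∀ᶠ x in 𝓝[<] (1 : ℝ), rateH β₀ p x < 0 :=
        ((continuous_rateH β₀ p).continuousAt.eventually
          (gt_mem_nhds (by rw [rateH_one]; linarith))).filter_mono nhdsWithin_le_nhds
      obtain ⟨v, hv, hv'⟩ := (hev.and (Ioo_mem_nhdsLT h₀.t_lt)).exists
      exact ⟨v, hv', hv⟩
    -- For `β` above `η_p v` the point `v` lies left of `t`, so the null rate at `t` is below its
    -- negative value at `v`.
    refine ⟨etaReal p v, fun β hβ hB => ?_⟩
    obtain ⟨s, t, h, hpos⟩ := exists_isLevelPair_of_lt hp hβ₀ ⟨x, hx, hxr⟩ hβ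
    have htt := (h₀.lt_of_lt h hβ).2
    have hvt : v < t := by
      by_contra! hc
      rcases hc.lt_or_eq with hc | rfl
      · linarith [h.gt_right v hc hv.2]
      · linarith [h.eta_t]
    have hneg := h₀.anti_right hp ⟨hv.1.le, hv.2.le⟩ ⟨htt.le, h.t_lt.le⟩ hvt
    have hmax : max 0 (rateH β₀ p t) = 0 := max_eq_left (by linarith)
    have hc₁ : 0 < 2 * (rateH β₀ p t₀ - 0) := by linarith
    have hlt : 2 * (rateH β₀ p t₀ - 0) < 2 * (rateH β₀ p t₀ - rateH β₀ p t) := by linarith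
    have hT := fun est (hest : TracksEta p est) =>
      hmax ▸ isBahadurSlope_of_tracksEta hest hp hβ₀ hβ h₀ hpos₀ h hpos
    exact ⟨_, _, hc₁, hc₁.trans hlt, hT _ (tracksEta_mple hp), hT _ (tracksEta_mpleClosedForm p),
      isBahadurSlope_mle hp hβ₀ hβ h₀ hpos₀ h hpos, hlt.ne,
      fun δ hδ hδ' => optimalSampleSize_ne hc₁ (hc₁.trans hlt) hlt.ne hδ hδ',
      (one_lt_div hc₁).2 hlt⟩
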